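/- Consider the synchronous CONGEST model. The network is a connected simple graph $G_U$ with $n$ nodes, $m$ edges and diameter $D$. The nodes carry distinct identifiers, which are natural numbers smaller than $n^{a}$ for a constant $a$. They know $n$, have unbounded local computational power, and have private, independent sources of randomness. In every round each node may send a message of $O(\log n)$ bits to each of its neighbours. An adversary chooses a non-empty set $R$ of nodes (for example a single node, or all the nodes). Every node in $R$ receives as input the same known graph $G_K$ on $n$ nodes and the same proximity parameter $\epsilon\in(0,1)$; the other nodes receive no input. The graph $G_U$ is \emph{$\epsilon$-far from being isomorphic to} $G_K$ if at least $\epsilon m$ edges have to be inserted into or deleted from $G_U$ in order to obtain a graph that is isomorphic to $G_K$. \textbf{Theorem.} For all constants $a$, $c$ and $\delta>0$ there are constants $B$ and $K$ and a randomized distributed algorithm in the CONGEST model, with messages of at most $B\log_2 n$ bits, such that the following holds for all $n$, all connected networks $G_U$ on $n$ nodes with $m\ge\delta n^2$ edges, all assignments of distinct identifiers smaller than $n^a$, all graphs $G_K$ on $n$ nodes, all $\epsilon\in(0,1)$ and all non-empty sets $R$ of nodes. \begin{itemize} \item In every execution, every node halts with output accept or reject within $K\cdot\bigl(D+(\epsilon^{-1}\log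 n)^2\bigr)$ rounds. \item If $G_U$ is isomorphic to $G_K$, then with probability at least $1-1/n^{c}$ all nodes output accept. \item If $G_U$ is $\epsilon$-far from being isomorphic to $G_K$, then with probability at least $1-1/n^{c}$ at least one node outputs reject. \end{itemize} -/

import Mathlib

/-- `G` is `ε`-far from being isomorphic to `H`: at least `ε * m` edges have to be inserted into or
deleted from `G`, where `m` is the number of edges of `G`, before it becomes isomorphic to `H`. -/
def IsFarFromIso {V W : Type} (ε : ℝ) (G : SimpleGraph V) (H : SimpleGraph W) : Prop :=
  ∀ G' : SimpleGraph V, Nonempty (G' ≃g H) →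
    ε * (G.edgeSet.ncard : ℝ) ≤ ((symmDiff G.edgeSet G'.edgeSet).ncard : ℝ)

/-- The final decision of a node. -/
inductive Verdict : Type
  | accept
  | reject

/-- A randomized algorithm for networks with `n` nodes in the CONGEST model. In each round a node
may send over each incident link one of `n ^ B` symbols, that is `B * log₂ n` bits (or stay silent,
`none`). Identifiers are natural numbers, and a node names its links by the identifiers of the nodes
at their other ends; it is not told in advance which links it has. Local computation is unbounded.

* `Seed` is the finite set from which every node draws its private randomness, uniformly at random
  and independently of the other nodes.
* `init` gives the starting state of a node from its identifier, its input and its seed. The input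
  is either nothing or a graph on `n` nodes together with a proximity parameter.
* `send s i` is the message sent over the link to the node with identifier `i`, if there is one.
* `receive s M` is the new state of a node after it has received the messages in `M`, each paired
  with the identifier of its sender.
* `output s = some b` means that a node in state `s` has halted with verdict `b`. -/
structure CongestAlgorithm (n B : ℕ) where
  Seed : Type
  seed_finite : Finite Seed
  seed_nonempty : Nonempty Seed
  State : Type
  init : ℕ → Option (SimpleGraph (Fin n) × ℝ) → Seed → State
  send : State → ℕ → Option (Fin (n ^ B))
  receive : State → Set (ℕ × Fin (n ^ B)) → State
  output : State → Option Verdict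

namespace CongestAlgorithm

variable {n B : ℕ} (A : CongestAlgorithm n B)

/-- The message that a node in state `s` puts on the link to the node with identifier `i`;
halted nodes are silent. -/
def outgoing (s : A.State) (i : ℕ) : Option (Fin (n ^ B)) :=
  match A.output s with
  | none => A.send s i
  | some _ => none

/-- The new state of a node in state `s` that receives the messages in `M`; halted nodes do not
change their state. -/
def update (s : A.State) (M : Set (ℕ × Fin (n ^ B))) : A.State :=
  match A.output s with
  | none => A.receive s M
  | some _ => s

/-- The states of all nodes of the network `G` after a number of synchronous rounds, given the
identifiers, the inputs and the random seeds of the nodes. -/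
def run (G : SimpleGraph (Fin n)) (ident : Fin n → ℕ)
    (input : Fin n → Option (SimpleGraph (Fin n) × ℝ)) (seed : Fin n → A.Seed) :
    ℕ → Fin n → A.State
  | 0 => fun v => A.init (ident v) (input v) (seed v)
  | t + 1 => fun v =>
      A.update (run G ident input seed t v)
        {p | ∃ u, G.Adj u v ∧ p.1 = ident u ∧
          A.outgoing (run G ident input seed t u) (ident v) = some p.2}

/-- The verdict (if any) of node `v` after `t` rounds. -/
def verdict (G : SimpleGraph (Fin n)) (ident : Fin n → ℕ)
    (input : Fin n → Option (SimpleGraph (Fin n) × ℝ)) (seed : Fin n → A.Seed)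
    (t : ℕ) (v : Fin n) : Option Verdict :=
  A.output (A.run G ident input seed t v)

/-- The probability of an event when the nodes draw their seeds uniformly and independently. -/
noncomputable def prob (E : Set (Fin n → A.Seed)) : ℝ :=
  (E.ncard : ℝ) / (Nat.card (Fin n → A.Seed) : ℝ)

end CongestAlgorithm

open Classical in
/-- The nodes in `R` receive the known graph `H` and the proximity parameter `ε`, the other nodes
receive nothing. -/
noncomputable def testerInput {n : ℕ} (R : Set (Fin n)) (H : SimpleGraph (Fin n)) (ε : ℝ) :
    Fin n → Option (SimpleGraph (Fin n) × ℝ) :=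
  fun v => if v ∈ R then some (H, ε) else none

/-! The leader compares random sketches of the network and of the known graph. About `N`, of order
`log n / (δ ε)`, nodes sample themselves and draw random weights; the label of a vertex is the total
weight of its neighbours. If `v` has more than `δ ε n / 16` neighbours that `v'` lacks, then with
high probability one of them is sampled and its weight separates the two labels
(`unifProb_labelOf_eq_le`). So vertices with equal labels have nearly equal neighbourhoods.

What matters about a labelled graph is how many vertices carry each label and how many edges join
each two labels. Suppose some weights on the known graph give the same numbers. Then a
label-preserving bijection exists, and it matches blocks of the two adjacency matrices with equal
sums. A block of the network is nearly constant along rows and columns, which forces it to be mostly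
0 or mostly 1, so a block with the same sum differs from it in few places (`block_sum_abs_sub_le`).
Hence the network is close to the known graph (`exists_iso_close`), which contradicts farness.

These numbers are the coefficients of a polynomial over `ZMod p` that is a sum of local terms
(`fingerprint_X_eq`, `card_eq_of_fingerprint_eq`). Its values at `k` random points chosen by the
leader are added up along a breadth-first tree, pipelined, in time linear in `D + k`
(`sum_level_eq_sum`). The leader tries all weight functions on the known graph with at most `M = 4 *
N` nonzero weights. There are at most `(n * W) ^ M` of them, with `W` the weight bound, and a wrong
one survives with probability at most `n ^ (-k)`, so `k` proportional to `M` suffices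
(`unifProb_accept_le`). In the isomorphic case the true weights, carried over by the isomorphism,
are among those tried unless more than `M` nodes are sampled (`unifProb_sample_large_le`).

The leader and the tree are found by flooding with a doubling guess for the diameter, after which
the nodes verify that they agree (`search_dichotomy`). -/

/-! ### Leader search by flooding and checking. -/

/-- One round of flooding: every vertex lowers its value to one more than the smallest value of a
neighbour, if that is smaller. -/
noncomputable def floodStep {V : Type*} (G : SimpleGraph V) (f : V → ℕ) (v : V) : ℕ :=
  sInf (insert (f v) {y | ∃ u, G.Adj u v ∧ y = f u + 1})

open Classical in
/-- One round of checking: a vertex that sees a neighbour with another leader code `f u / L` gives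
up and takes the value `top`. -/
noncomputable def checkStep {V : Type*} (G : SimpleGraph V) (L top : ℕ) (f : V → ℕ) (v : V) : ℕ :=
  if ∃ u, G.Adj u v ∧ f u / L ≠ f v / L then top else f v

section Flood

variable {V : Type*} {G : SimpleGraph V}

lemma floodStep_le_self (f : V → ℕ) (v : V) : floodStep G f v ≤ f v :=
  Nat.sInf_le (Set.mem_insert _ _)

lemma floodStep_le_of_adj (f : V → ℕ) {u v : V} (h : G.Adj u v) : floodStep G f v ≤ f u + 1 :=
  Nat.sInf_le (Set.mem_insert_of_mem _ ⟨u, h, rfl⟩)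

lemma floodStep_eq_or (f : V → ℕ) (v : V) :
    floodStep G f v = f v ∨ ∃ u, G.Adj u v ∧ floodStep G f v = f u + 1 := by
  have h := Nat.sInf_mem (s := insert (f v) {y | ∃ u, G.Adj u v ∧ y = f u + 1})
    (Set.insert_nonempty _ _)
  rcases h with h | ⟨u, hu, h⟩
  · exact Or.inl h
  · exact Or.inr ⟨u, hu, h⟩

lemma SimpleGraph.Connected.exists_adj_dist_add_one (hG : G.Connected) {v w : V}
    (h : v ≠ w) : ∃ u, G.Adj u v ∧ G.dist u w + 1 = G.dist v w := by
  obtain ⟨p, hp⟩ := hG.exists_walk_length_eq_dist v w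
  cases p with
  | nil => exact absurd rfl h
  | @cons _ u _ huv q =>
    refine ⟨u, huv.symm, ?_⟩
    have h1 := SimpleGraph.dist_le q
    have h2 := hG.dist_triangle (u := v) (v := u) (w := w)
    have h3 : G.dist v u = 1 := SimpleGraph.dist_eq_one_iff_adj.2 huv
    simp only [SimpleGraph.Walk.length_cons] at hp
    omega

lemma SimpleGraph.Connected.dist_le_add_one_of_adj (hG : G.Connected) {u v : V} (w : V)
    (h : G.Adj u v) : G.dist v w ≤ G.dist u w + 1 := by
  have h2 := hG.dist_triangle (u := v) (v := u) (w := w)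
  have h3 : G.dist v u = 1 := SimpleGraph.dist_eq_one_iff_adj.2 h.symm
  omega

lemma SimpleGraph.Connected.exists_dist_eq (hG : G.Connected) (w : V) (k : ℕ) :
    ∀ (d : ℕ) (v : V), G.dist v w = k + d → ∃ y, G.dist y w = k ∧ G.dist v y ≤ d := by
  intro d
  induction d with
  | zero => exact fun v hv => ⟨v, hv, by simp⟩
  | succ d ih =>
    intro v hv
    have hne : v ≠ w := by
      rintro rfl
      simp at hv
    obtain ⟨u, huv, hu⟩ := hG.exists_adj_dist_add_one hne
    obtain ⟨y, hy, hyd⟩ := ih u (by omega)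
    exact ⟨y, hy, by have := hG.dist_le_add_one_of_adj y huv; omega⟩

variable {R : Set V} {code : V → ℕ} {L C : ℕ}

lemma flood_le (hG : G.Connected) {s : V → ℕ} (hs : ∀ v ∈ R, s v = code v * L) (t : ℕ) :
    ∀ v, ∀ r ∈ R, G.dist v r ≤ t → (floodStep G)^[t] s v ≤ code r * L + G.dist v r := by
  induction t with
  | zero =>
    intro v r hr hd
    have : v = r := hG.dist_eq_zero_iff.1 (by omega)
    subst this
    simp [hs v hr]
  | succ t ih =>
    intro v r hr hd
    rw [Function.iterate_succ_apply']
    by_cases hvr : G.dist v r ≤ t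
    · exact (floodStep_le_self _ _).trans (ih v r hr hvr)
    · obtain ⟨u, huv, hu⟩ := hG.exists_adj_dist_add_one (v := v) (w := r) (by
        rintro rfl
        simp at hvr)
      have h1 := floodStep_le_of_adj ((floodStep G)^[t] s) huv
      have h2 := ih u r hr (by omega)
      omega

/-- A value taken over from a neighbour is at least `code r * L + dist` by the triangle inequality
and at most that by `flood_le`, so no estimate of a distance is ever too large. -/
lemma flood_eq_top_or (hG : G.Connected) {s : V → ℕ} {top : ℕ} (hs : ∀ v ∈ R, s v = code v * L)
    (hs' : ∀ v ∉ R, s v = top) (hR : ∀ v ∈ R, s v ≤ top) (t : ℕ) :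
    ∀ v, (floodStep G)^[t] s v ≤ top ∧ ((floodStep G)^[t] s v = top ∨
      ∃ r ∈ R, G.dist v r ≤ t ∧ (floodStep G)^[t] s v = code r * L + G.dist v r) := by
  induction t with
  | zero =>
    intro v
    by_cases hv : v ∈ R
    · exact ⟨hR v hv, Or.inr ⟨v, hv, by simp, by simp [hs v hv]⟩⟩
    · exact ⟨(hs' v hv).le, Or.inl (hs' v hv)⟩
  | succ t ih =>
    intro v
    have hle := flood_le hG hs (t + 1) v
    rw [Function.iterate_succ_apply'] at hle ⊢
    refine ⟨(floodStep_le_self _ _).trans (ih v).1, ?_⟩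
    rcases floodStep_eq_or ((floodStep G)^[t] s) v with h | ⟨u, huv, h⟩
    · rw [h]
      rcases (ih v).2 with h' | ⟨r, hr, hd, h'⟩
      · exact Or.inl h'
      · exact Or.inr ⟨r, hr, by omega, h'⟩
    · rcases (ih u).2 with h' | ⟨r, hr, hd, h'⟩
      · have h1 := floodStep_le_self (G := G) ((floodStep G)^[t] s) v
        have h2 := (ih v).1
        omega
      · have h1 := hG.dist_le_add_one_of_adj r huv
        have h2 := hle r hr (by omega)
        exact Or.inr ⟨r, hr, by omega, by omega⟩

lemma iterate_checkStep_of_forall_eq {top : ℕ} {f : V → ℕ} (h : ∀ u v, f u / L = f v / L) (k : ℕ) :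
    (checkStep G L top)^[k] f = f := by
  have : checkStep G L top f = f := by
    funext v
    rw [checkStep, if_neg]
    rintro ⟨u, -, hu⟩
    exact hu (h u v)
  exact Function.iterate_fixed this k

/-- As `L` divides `top`, the leader code of `top` exceeds that of every smaller value. A vertex
that has given up therefore makes its neighbours give up, one edge per round, and surviving `k`
rounds certifies agreement in the ball of radius `k`. -/
lemma div_eq_of_iterate_checkStep_ne_top (hG : G.Connected) {top : ℕ} {f : V → ℕ} (hL : 0 < L)
    (hf : ∀ v, f v ≤ top) (htop : L ∣ top) (k : ℕ) :
    ∀ v, (checkStep G L top)^[k] f v ≤ top ∧ ((checkStep G L top)^[k] f v ≠ top →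
      (checkStep G L top)^[k] f v = f v ∧ ∀ u, G.dist v u ≤ k → f u / L = f v / L) := by
  induction k with
  | zero =>
    intro v
    refine ⟨hf v, fun _ => ⟨rfl, fun u hu => ?_⟩⟩
    rw [hG.dist_eq_zero_iff.1 (Nat.le_zero.1 hu)]
  | succ k ih =>
    intro v
    rw [Function.iterate_succ_apply', checkStep]
    split_ifs with hex
    · exact ⟨le_rfl, fun h => absurd rfl h⟩
    · refine ⟨(ih v).1, fun hne => ⟨((ih v).2 hne).1, fun y hy => ?_⟩⟩
      push Not at hex
      by_cases hvy : v = y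
      · rw [hvy]
      obtain ⟨u, huv, hu⟩ := hG.exists_adj_dist_add_one hvy
      have hlt : (checkStep G L top)^[k] f v < top := lt_of_le_of_ne (ih v).1 hne
      have hune : (checkStep G L top)^[k] f u ≠ top := by
        intro h
        have h1 := hex u huv
        rw [h] at h1
        obtain ⟨c, rfl⟩ := htop
        rw [Nat.mul_div_cancel_left _ hL] at h1
        have := (Nat.div_lt_iff_lt_mul hL).2 (by rw [mul_comm]; exact hlt)
        omega
      have h1 := hex u huv
      rw [((ih u).2 hune).1, ((ih v).2 hne).1] at h1
      rw [((ih u).2 hune).2 y (by omega), h1]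

/-- After `Δ` rounds of flooding and `2 * Δ + 1` rounds of checking, either every vertex has given
up, which happens only if the diameter exceeds `Δ`, or all vertices agree on a leader at distance
at most `Δ` and know their distances from it. -/
lemma search_dichotomy (hG : G.Connected) {s : V → ℕ} (hs : ∀ v ∈ R, s v = code v * L)
    (hs' : ∀ v ∉ R, s v = C * L) (hcode : Set.InjOn code R) (hC : ∀ v ∈ R, code v < C)
    (hL : ∀ u v, G.dist u v < L) (hR : R.Nonempty) (Δ : ℕ) :
    ((∀ v, (checkStep G L (C * L))^[2 * Δ + 1] ((floodStep G)^[Δ] s) v = C * L) ∧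
      ∃ u v, Δ < G.dist u v) ∨
    ∃ root ∈ R, ∀ v, G.dist v root ≤ Δ ∧
      (checkStep G L (C * L))^[2 * Δ + 1] ((floodStep G)^[Δ] s) v =
        code root * L + G.dist v root := by
  obtain ⟨r₀, hr₀⟩ := hR
  have hLpos : 0 < L := lt_of_le_of_lt (Nat.zero_le _) (hL r₀ r₀)
  have hlt : ∀ r ∈ R, ∀ v, code r * L + G.dist v r < C * L := by
    intro r hr v
    have h1 : (code r + 1) * L ≤ C * L := Nat.mul_le_mul_right _ (hC r hr)
    have h2 := hL v r
    rw [add_mul] at h1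
    omega
  have hdiv : ∀ r v, (code r * L + G.dist v r) / L = code r := by
    intro r v
    rw [mul_comm, Nat.mul_add_div hLpos, Nat.div_eq_of_lt (hL v r), add_zero]
  have hflood := flood_eq_top_or hG hs hs' (fun v hv => by
    rw [hs v hv]; exact Nat.mul_le_mul_right _ (hC v hv).le) Δ
  have hle := flood_le hG hs Δ
  set f := (floodStep G)^[Δ] s with hf
  have hcheck := div_eq_of_iterate_checkStep_ne_top hG hLpos (fun v => (hflood v).1)
    (Dvd.intro_left C rfl) (2 * Δ + 1)
  by_cases h : ∃ v, (checkStep G L (C * L))^[2 * Δ + 1] f v ≠ C * L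
  · right
    obtain ⟨v, hv⟩ := h
    obtain ⟨hfv, hball⟩ := (hcheck v).2 hv
    rw [hfv] at hv
    obtain ⟨r, hr, hd, hval⟩ := (hflood v).2.resolve_left hv
    have near : ∀ y, G.dist v y ≤ 2 * Δ + 1 → G.dist y r ≤ Δ ∧ f y = code r * L + G.dist y r := by
      intro y hy
      have h1 := hball y hy
      rw [hval, hdiv] at h1
      rcases (hflood y).2 with h2 | ⟨r', hr', hd', h2⟩
      · rw [h2, Nat.mul_div_cancel _ hLpos] at h1
        exact absurd h1 (hC r hr).ne'
      · rw [h2, hdiv] at h1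
        obtain rfl := hcode hr' hr h1
        exact ⟨hd', h2⟩
    -- This is why there are `2 * Δ + 1` checking rounds. A vertex too far from `r` yields a vertex
    -- `z` at distance exactly `Δ + 1` from `r`, hence within `2 * Δ + 1` of `v`. It would have to
    -- carry the code of `r`, which cannot have reached it in `Δ` rounds.
    have all : ∀ y, G.dist y r ≤ Δ := by
      intro y
      by_contra hy
      obtain ⟨z, hz, -⟩ := hG.exists_dist_eq r (Δ + 1) (G.dist y r - (Δ + 1)) y (by omega)
      have h1 := hG.dist_triangle (u := v) (v := r) (w := z)
      rw [SimpleGraph.dist_comm (u := r)] at h1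
      have := (near z (by omega)).1
      omega
    have near' : ∀ y, f y = code r * L + G.dist y r := by
      intro y
      have h1 := hG.dist_triangle (u := v) (v := r) (w := y)
      rw [SimpleGraph.dist_comm (u := r)] at h1
      have := all y
      exact (near y (by omega)).2
    refine ⟨r, hr, fun y => ⟨all y, ?_⟩⟩
    rw [iterate_checkStep_of_forall_eq, near']
    intro u w
    rw [near', near', hdiv, hdiv]
  · left
    push Not at h
    refine ⟨h, ?_⟩
    by_contra hd
    push Not at hd
    -- If all distances are at most `Δ`, the smallest code wins everywhere, so nobody would have
    -- given up.
    have hne : ∀ v, ∃ r ∈ R, f v = code r * L + G.dist v r ∧ ∀ r' ∈ R, code r ≤ code r' := by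
      intro v
      have h1 := hle v r₀ hr₀ (hd _ _)
      have h2 := hlt r₀ hr₀ v
      obtain ⟨r, hr, -, h3⟩ := (hflood v).2.resolve_left (by omega)
      refine ⟨r, hr, h3, fun r' hr' => ?_⟩
      have h4 := Nat.div_le_div_right (c := L) (hle v r' hr' (hd _ _))
      rwa [h3, hdiv, hdiv] at h4
    have hconst : ∀ u v, f u / L = f v / L := by
      intro u v
      obtain ⟨r, hr, h1, h2⟩ := hne u
      obtain ⟨r', hr', h1', h2'⟩ := hne v
      rw [h1, h1', hdiv, hdiv]
      exact le_antisymm (h2 r' hr') (h2' r hr)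
    have h1 := h r₀
    rw [iterate_checkStep_of_forall_eq hconst] at h1
    have h2 := hle r₀ r₀ hr₀ (hd _ _)
    have h3 := hlt r₀ hr₀ r₀
    omega

end Flood

/-! ### The tester as a state machine. -/

/-- The parameters of the isomorphism tester on networks with `n` nodes. -/
structure TesterParams (n : ℕ) where
  idBound : ℕ
  weightBound : ℕ
  weightBound_pos : 0 < weightBound
  p : ℕ
  prime : p.Prime
  coins : ℕ
  samples : ℝ → ℕ
  reps : ℕ → ℕ
  decide : SimpleGraph (Fin n) → ℝ → (ℕ → ZMod p) → (ℕ → ZMod p) → Verdict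

namespace CongestAlgorithm

variable {n B : ℕ} {A : CongestAlgorithm n B} {s : A.State}

lemma update_of_output_eq_none (h : A.output s = none) (M : Set (ℕ × Fin (n ^ B))) :
    A.update s M = A.receive s M := by
  simp only [update, h]

lemma outgoing_of_output_eq_none (h : A.output s = none) (i : ℕ) :
    A.outgoing s i = A.send s i := by
  simp only [outgoing, h]

end CongestAlgorithm

namespace TesterParams

/-- The stages that a node of the tester runs through. All of them but the last carry the current
guess for the diameter. -/
inductive Stage (p : ℕ) : Type
  | flood (guess clock value : ℕ)
  | check (guess clock value : ℕ)
  | adopt (guess value : ℕ)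
  | weigh (guess value parent : ℕ)
  | label (guess value parent label : ℕ)
  | spread (guess value parent : ℕ) (fp : ZMod p → ZMod p) (clock : ℕ) (coin : ℕ → ZMod p)
  | collect (guess value parent : ℕ) (fp : ZMod p → ZMod p) (coin : ℕ → ZMod p) (clock : ℕ)
      (acc : ZMod p) (log : ℕ → ZMod p)
  | done (verdict : Verdict)

variable {n : ℕ} (P : TesterParams n)

instance : Fact P.p.Prime := ⟨P.prime⟩

/-- The private randomness of a node: whether it is sampled, its weight, and its coins. -/
abbrev Seed : Type := Fin n × Fin P.weightBound × (Fin P.coins → ZMod P.p)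

variable {P} in
/-- The weight of a node when about `N` nodes are sampled. -/
def seedWeight (N : ℕ) (s : P.Seed) : ℕ := if s.1.val < N then s.2.1.val else 0

variable {P} in
/-- The coins of a node as a sequence. -/
def seedCoin (s : P.Seed) (j : ℕ) : ZMod P.p := if h : j < P.coins then s.2.2 ⟨j, h⟩ else 0

/-- The value of a node that knows of no leader. -/
def top : ℕ := P.idBound * (n + 1) * n

/-- The code of a potential leader with identifier `i` and proximity parameter `ε`. -/
noncomputable def code (i : ℕ) (ε : ℝ) : ℕ := i * (n + 1) + P.samples ε

/-- The value with which a node starts. -/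
noncomputable def start (i : ℕ) : Option (SimpleGraph (Fin n) × ℝ) → ℕ
  -- Values have the form `code * n + distance`. Their digits are an identifier, a sample size (base
  -- `n + 1`) and a distance (base `n`), so the flooding also tells the nodes without input how many
  -- nodes to sample.
  | some (_, ε) => P.code i ε * n
  | none => P.top

/-- The sample size encoded in a value. -/
def sizeOf (n x : ℕ) : ℕ := x / n % (n + 1)

/-- The coordinate that a node at distance `d` from the leader reports at time `t`, when the
distances are at most `Δ`. -/
def coordinate (Δ d t : ℕ) : ℕ := t + d - Δ

/-- What a node knows from the start: its identifier, its input and its seed. -/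
abbrev Node : Type := ℕ × Option (SimpleGraph (Fin n) × ℝ) × P.Seed

variable {P}

/-- The contribution of a node to the sum that it reports at a given time. -/
def report (Δ x : ℕ) (fp : ZMod P.p → ZMod P.p) (coin : ℕ → ZMod P.p) (t : ℕ) (acc : ZMod P.p) :
    ZMod P.p :=
  -- The coins arrive with a delay equal to the depth `x % n`, so coin `j` of the leader is stored
  -- at index `x % n + j`.
  fp (coin (x % n + coordinate Δ (x % n) t)) + acc

/-- The number that a node sends to all its neighbours. -/
def message (nd : P.Node) : Stage P.p → ℕ
  | .flood _ _ x => x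
  | .check _ _ x => x
  | .adopt _ x => x
  | .weigh _ x _ => seedWeight (sizeOf n x) nd.2.2
  | .label _ _ _ l => l
  | .spread _ _ _ _ t coin => (coin t).val
  -- All neighbours get the same message, so the sum is preceded by the identifier of the parent it
  -- is meant for, as the higher digit in base `p`.
  | .collect Δ x par fp coin t acc _ => par * P.p + (report (n := n) Δ x fp coin t acc).val
  | .done _ => 0

/-- The verdict of a node at the end. -/
noncomputable def conclude (nd : P.Node) (Δ x : ℕ) (log : ℕ → ZMod P.p) : Verdict :=
  match nd.2.1 with
  | some (H, ε) =>
      -- Only the leader has distance 0. The sum for point `j` reaches it at time `Δ + j`; earlier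
      -- entries of the log are incomplete.
      if x % n = 0 then P.decide H ε (seedCoin nd.2.2) (fun j => log (Δ + j)) else .accept
  | none => .accept

open Classical in
/-- The value of a node after it has compared its leader code `x / L` with those of its
neighbours. -/
noncomputable def recheck (L top x : ℕ) (M : Set (ℕ × ℕ)) : ℕ :=
  if ∃ q ∈ M, q.2 / L ≠ x / L then top else x

/-- The next stage of a node that receives the pairs of identifiers and numbers in `M`. -/
noncomputable def next (nd : P.Node) : Stage P.p → Set (ℕ × ℕ) → Stage P.p
  | .flood Δ t x, M =>
      if t + 1 < Δ then .flood Δ (t + 1) (sInf (insert x {y | ∃ q ∈ M, y = q.2 + 1}))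
      else .check Δ 0 (sInf (insert x {y | ∃ q ∈ M, y = q.2 + 1}))
  | .check Δ t x, M =>
      if t + 1 < 2 * Δ + 1 then
        .check Δ (t + 1) (recheck n P.top x M)
      else if (recheck n P.top x M) = P.top then
        .flood (2 * Δ) 0 (P.start nd.1 nd.2.1)
      else .adopt Δ (recheck n P.top x M)
  | .adopt Δ x, M => .weigh Δ x
      (if x % n = 0 then nd.1 else sInf {i | ∃ q ∈ M, q.1 = i ∧ q.2 + 1 = x})
  | .weigh Δ x par, M => .label Δ x par (∑ᶠ q ∈ M, q.2)
  | .label Δ x par l, M =>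
      .spread Δ x par
        (fun z => z ^ l * (z ^ (n * P.weightBound) ^ 2 +
          ∑ᶠ q ∈ M, z ^ (n * P.weightBound * q.2)))
        0 (if x % n = 0 then seedCoin nd.2.2 else 0)
  | .spread Δ x par fp t coin, M =>
      if t + 1 < Δ + P.reps (sizeOf n x) then
        .spread Δ x par fp (t + 1) (if x % n = 0 then coin else
          Function.update coin (t + 1) ((sInf {y | (par, y) ∈ M} : ℕ) : ZMod P.p))
      else
        .collect Δ x par fp (if x % n = 0 then coin else
          Function.update coin (t + 1) ((sInf {y | (par, y) ∈ M} : ℕ) : ZMod P.p)) 0 0 0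
  | .collect Δ x par fp coin t acc log, M =>
      if t + 1 < Δ + P.reps (sizeOf n x) then
        .collect Δ x par fp coin (t + 1)
          (∑ᶠ q ∈ M, if q.2 / P.p = nd.1 then (q.2 : ZMod P.p) else 0)
          (Function.update log t (report (n := n) Δ x fp coin t acc))
      else
        .done (conclude nd Δ x
          (Function.update log t (report (n := n) Δ x fp coin t acc)))
  | .done v, _ => .done v

variable (P)

/-- The distributed isomorphism tester with given parameters. -/
noncomputable def algorithm (hn : 0 < n) (B : ℕ) : CongestAlgorithm n B where
  Seed := P.Seed
  seed_finite := inferInstance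
  seed_nonempty := ⟨⟨0, hn⟩, ⟨0, P.weightBound_pos⟩, 0⟩
  State := P.Node × Stage P.p
  init i inp s := ((i, inp, s), .flood 1 0 (P.start i inp))
  send s _ := if h : message s.1 s.2 < n ^ B then some ⟨message s.1 s.2, h⟩ else none
  receive s M := (s.1, next s.1 s.2 ((fun q => (q.1, q.2.val)) '' M))
  output s := match s.2 with
    | .done v => some v
    | _ => none

/-- The pairs of identifiers and numbers that a node receives when every vertex `u` sends `x u`. -/
def inbox (G : SimpleGraph (Fin n)) (ident : Fin n → ℕ) (x : Fin n → ℕ) (v : Fin n) :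
    Set (ℕ × ℕ) :=
  {q | ∃ u, G.Adj u v ∧ q = (ident u, x u)}

/-! ### Single rounds of an execution. -/

section Run

variable {P} (hn : 0 < n) {B : ℕ} {G : SimpleGraph (Fin n)} {ident : Fin n → ℕ}
  {input : Fin n → Option (SimpleGraph (Fin n) × ℝ)} {seed : Fin n → P.Seed}

/-- The configuration of the network in which the nodes are in given stages. -/
def config (ident : Fin n → ℕ) (input : Fin n → Option (SimpleGraph (Fin n) × ℝ))
    (seed : Fin n → P.Seed) (st : Fin n → Stage P.p) : Fin n → P.Node × Stage P.p :=
  fun v => ((ident v, input v, seed v), st v)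

lemma run_succ_eq_config {t : ℕ} {st : Fin n → Stage P.p}
    (h : (P.algorithm hn B).run G ident input seed t = config ident input seed st)
    (hst : ∀ v r, st v ≠ .done r)
    (hm : ∀ v, message (ident v, input v, seed v) (st v) < n ^ B) :
    (P.algorithm hn B).run G ident input seed (t + 1) = config ident input seed (fun v =>
      next (ident v, input v, seed v) (st v)
        (inbox G ident (fun u => message (ident u, input u, seed u) (st u)) v)) := by
  have hout : ∀ v, (P.algorithm hn B).output (config ident input seed st v) = none := by
    intro v
    have := hst v
    simp only [algorithm, config]
  funext v
  change (P.algorithm hn B).update ((P.algorithm hn B).run G ident input seed t v) {p | ∃ u,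
    G.Adj u v ∧ p.1 = ident u ∧ (P.algorithm hn B).outgoing
      ((P.algorithm hn B).run G ident input seed t u) (ident v) = some p.2} = _
  rw [h, CongestAlgorithm.update_of_output_eq_none (hout v)]
  simp only [CongestAlgorithm.outgoing_of_output_eq_none (hout _)]
  have hM : (fun q : ℕ × Fin (n ^ B) => (q.1, q.2.val)) ''
      {p | ∃ u, G.Adj u v ∧ p.1 = ident u ∧
        (P.algorithm hn B).send (config ident input seed st u) (ident v) = some p.2} =
      inbox G ident (fun u => message (ident u, input u, seed u) (st u)) v := by
    ext q
    constructor
    · rintro ⟨⟨i, m⟩, ⟨u, hu, hi, hs⟩, rfl⟩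
      simp only [algorithm, config, hm u, dite_true, Option.some.injEq] at hs
      exact ⟨u, hu, by simp only at hi; rw [hi, ← hs]⟩
    · rintro ⟨u, hu, rfl⟩
      exact ⟨(ident u, ⟨_, hm u⟩), ⟨u, hu, rfl, by simp [algorithm, config, hm u]⟩, rfl⟩
  exact congrArg (fun M => ((ident v, input v, seed v),
    next (ident v, input v, seed v) (st v) M)) hM

lemma verdict_eq_some_of_le {t T : ℕ} (hT : t ≤ T) {r : Fin n → Verdict}
    (h : (P.algorithm hn B).run G ident input seed t =
      config ident input seed (fun v => .done (r v))) (v : Fin n) :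
    (P.algorithm hn B).verdict G ident input seed T v = some (r v) := by
  have hrun : (P.algorithm hn B).run G ident input seed T =
      config ident input seed (fun v => .done (r v)) := by
    induction T, hT using Nat.le_induction with
    | base => exact h
    | succ T _ ih =>
      funext v
      change (P.algorithm hn B).update ((P.algorithm hn B).run G ident input seed T v) _ = _
      rw [ih]
      rfl
  change (P.algorithm hn B).output ((P.algorithm hn B).run G ident input seed T v) = _
  rw [hrun]
  rfl

lemma finsum_inbox (hid : Function.Injective ident) {A : Type*} [AddCommMonoid A]
    [DecidableRel G.Adj] (x : Fin n → ℕ) (g : ℕ × ℕ → A) (v : Fin n) :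
    ∑ᶠ q ∈ inbox G ident x v, g q = ∑ u with G.Adj u v, g (ident u, x u) := by
  have h : inbox G ident x v = (fun u => (ident u, x u)) '' ((Finset.univ.filter (G.Adj · v) :
      Finset (Fin n)) : Set (Fin n)) := by
    ext q
    simp only [inbox, Set.mem_ofPred_eq, Set.mem_image, Finset.coe_filter, Finset.mem_univ,
      true_and]
    exact ⟨fun ⟨u, h1, h2⟩ => ⟨u, h1, h2.symm⟩, fun ⟨u, h1, h2⟩ => ⟨u, h1, h2.symm⟩⟩
  rw [h, finsum_mem_image, finsum_mem_coe_finset]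
  intro u _ w _ huw
  exact hid (Prod.ext_iff.1 huw).1

end Run

end TesterParams

/-! ### Executions of the leader search. -/

lemma SimpleGraph.Connected.dist_lt_of_fin {n : ℕ} {G : SimpleGraph (Fin n)} (hG : G.Connected)
    (u v : Fin n) : G.dist u v < n := by
  obtain ⟨p, hp, hl⟩ := hG.exists_path_of_dist u v
  simpa [hl] using hp.length_lt

namespace TesterParams

variable {n : ℕ} {P : TesterParams n} {hn : 0 < n} {B : ℕ} {G : SimpleGraph (Fin n)}
  {ident : Fin n → ℕ} {input : Fin n → Option (SimpleGraph (Fin n) × ℝ)} {seed : Fin n → P.Seed}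

lemma exists_mem_inbox {x : Fin n → ℕ} {v : Fin n} {p : ℕ × ℕ → Prop} :
    (∃ q ∈ inbox G ident x v, p q) ↔ ∃ u, G.Adj u v ∧ p (ident u, x u) := by
  constructor
  · rintro ⟨_, ⟨u, hu, rfl⟩, h⟩
    exact ⟨u, hu, h⟩
  · rintro ⟨u, hu, h⟩
    exact ⟨_, ⟨u, hu, rfl⟩, h⟩

lemma sInf_insert_inbox (f : Fin n → ℕ) (v : Fin n) :
    sInf (insert (f v) {y | ∃ q ∈ inbox G ident f v, y = q.2 + 1}) = floodStep G f v := by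
  rw [floodStep]
  congr 2
  ext y
  exact exists_mem_inbox

lemma recheck_inbox (L top : ℕ) (f : Fin n → ℕ) (v : Fin n) :
    recheck L top (f v) (inbox G ident f v) = checkStep G L top f v := by
  have h := exists_mem_inbox (G := G) (ident := ident) (x := f) (v := v)
    (p := fun q => q.2 / L ≠ f v / L)
  by_cases hu : ∃ u, G.Adj u v ∧ f u / L ≠ f v / L
  · rw [recheck, checkStep, if_pos hu, if_pos (h.2 hu)]
  · rw [recheck, checkStep, if_neg hu, if_neg (mt h.1 hu)]

lemma run_flood (htop : P.top < n ^ B) {t Δ : ℕ} (hΔ : 0 < Δ) {s : Fin n → ℕ}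
    (hs : ∀ v, s v ≤ P.top)
    (h : (P.algorithm hn B).run G ident input seed t =
      config ident input seed (fun v => .flood Δ 0 (s v))) :
    (P.algorithm hn B).run G ident input seed (t + Δ) =
      config ident input seed (fun v => .check Δ 0 ((floodStep G)^[Δ] s v)) := by
  have hle : ∀ k v, (floodStep G)^[k] s v ≤ P.top := by
    intro k
    induction k with
    | zero => exact hs
    | succ k ih =>
      intro v
      rw [Function.iterate_succ_apply']
      exact (floodStep_le_self _ _).trans (ih v)
  have hstep : ∀ k, (P.algorithm hn B).run G ident input seed (t + k) =
      config ident input seed (fun v => .flood Δ k ((floodStep G)^[k] s v)) →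
      (P.algorithm hn B).run G ident input seed (t + (k + 1)) =
      config ident input seed (fun v => if k + 1 < Δ then
        .flood Δ (k + 1) ((floodStep G)^[k + 1] s v) else
        .check Δ 0 ((floodStep G)^[k + 1] s v)) := by
    intro k hk
    rw [← add_assoc, run_succ_eq_config hn hk (by simp)
      (fun v => lt_of_le_of_lt (hle k v) htop)]
    congr 1
    funext v
    simp only [next, message, sInf_insert_inbox, Function.iterate_succ_apply']
  have hk : ∀ k < Δ, (P.algorithm hn B).run G ident input seed (t + k) =
      config ident input seed (fun v => .flood Δ k ((floodStep G)^[k] s v)) := by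
    intro k
    induction k with
    | zero => exact fun _ => h
    | succ k ih =>
      intro hlt
      rw [hstep k (ih (by omega))]
      exact congrArg (config ident input seed) (funext fun v => if_pos hlt)
  obtain ⟨k, rfl⟩ := Nat.exists_eq_succ_of_ne_zero hΔ.ne'
  have := hstep k (hk k (by omega))
  simpa using this

lemma run_check (htop : P.top < n ^ B) {t Δ : ℕ} {f : Fin n → ℕ} (hf : ∀ v, f v ≤ P.top)
    (h : (P.algorithm hn B).run G ident input seed t =
      config ident input seed (fun v => .check Δ 0 (f v))) :
    (P.algorithm hn B).run G ident input seed (t + (2 * Δ + 1)) =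
      config ident input seed (fun v =>
        if (checkStep G n P.top)^[2 * Δ + 1] f v = P.top then
          .flood (2 * Δ) 0 (P.start (ident v) (input v))
        else .adopt Δ ((checkStep G n P.top)^[2 * Δ + 1] f v)) := by
  have hle : ∀ k v, (checkStep G n P.top)^[k] f v ≤ P.top := by
    intro k
    induction k with
    | zero => exact hf
    | succ k ih =>
      intro v
      rw [Function.iterate_succ_apply', checkStep]
      split_ifs
      · exact le_rfl
      · exact ih v
  have hstep : ∀ k, (P.algorithm hn B).run G ident input seed (t + k) =
      config ident input seed (fun v => .check Δ k ((checkStep G n P.top)^[k] f v)) →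
      (P.algorithm hn B).run G ident input seed (t + (k + 1)) =
      config ident input seed (fun v => if k + 1 < 2 * Δ + 1 then
        .check Δ (k + 1) ((checkStep G n P.top)^[k + 1] f v) else
        if (checkStep G n P.top)^[k + 1] f v = P.top then
          .flood (2 * Δ) 0 (P.start (ident v) (input v))
        else .adopt Δ ((checkStep G n P.top)^[k + 1] f v)) := by
    intro k hk
    rw [← add_assoc, run_succ_eq_config hn hk (by simp)
      (fun v => lt_of_le_of_lt (hle k v) htop)]
    congr 1
    funext v
    simp only [next, message, recheck_inbox, Function.iterate_succ_apply']
  have hk : ∀ k ≤ 2 * Δ, (P.algorithm hn B).run G ident input seed (t + k) =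
      config ident input seed (fun v => .check Δ k ((checkStep G n P.top)^[k] f v)) := by
    intro k
    induction k with
    | zero => exact fun _ => h
    | succ k ih =>
      intro hlt
      rw [hstep k (ih (by omega))]
      exact congrArg (config ident input seed) (funext fun v =>
        if_pos (show k + 1 < 2 * Δ + 1 by omega))
  have := hstep (2 * Δ) (hk _ le_rfl)
  simpa using this

section Search

variable {R : Set (Fin n)} {H : SimpleGraph (Fin n)} {ε : ℝ}

lemma code_lt (hN : P.samples ε ≤ n) {i : ℕ} (hi : i < P.idBound) :
    P.code i ε < P.idBound * (n + 1) := by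
  have : (i + 1) * (n + 1) ≤ P.idBound * (n + 1) := Nat.mul_le_mul_right _ hi
  rw [add_mul] at this
  rw [code]
  omega

lemma code_injective (hN : P.samples ε ≤ n) : Function.Injective fun i => P.code i ε := by
  intro i j hij
  have h := congrArg (· / (n + 1)) hij
  simp only [code] at h
  have h1 : ∀ i, (i * (n + 1) + P.samples ε) / (n + 1) = i := by
    intro i
    rw [mul_comm, Nat.mul_add_div (by omega), Nat.div_eq_of_lt (by omega), add_zero]
  rwa [h1, h1] at h

/-- A phase with guess `Δ` takes `3 * Δ + 1` rounds and fails only if `Δ` is below the diameter, so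
doubling stops by twice the diameter and the costs form a geometric sum. The search uses no
randomness: leader, guess and time come before the quantifier over seeds. -/
lemma exists_run_eq_adopt (hG : G.Connected) (hid : Function.Injective ident)
    (hlt : ∀ v, ident v < P.idBound) (htop : P.top < n ^ B) (hN : P.samples ε ≤ n)
    (hR : R.Nonempty) (hdiam : 0 < G.diam) :
    ∃ root ∈ R, ∃ Δ t, 0 < Δ ∧ Δ ≤ 2 * G.diam ∧ t ≤ 10 * Δ ∧ (∀ v, G.dist v root ≤ Δ) ∧
      ∀ seed, (P.algorithm hn B).run G ident (testerInput R H ε) seed t =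
        config ident (testerInput R H ε) seed
          (fun v => .adopt Δ (P.code (ident root) ε * n + G.dist v root)) := by
  classical
  have hediam : G.ediam ≠ ⊤ := SimpleGraph.ediam_ne_top_of_diam_ne_zero hdiam.ne'
  set s : Fin n → ℕ := fun v => P.start (ident v) (testerInput R H ε v) with hs
  have hsR : ∀ v ∈ R, s v = P.code (ident v) ε * n := by
    intro v hv
    simp [hs, testerInput, hv, start]
  have hsR' : ∀ v ∉ R, s v = P.top := by
    intro v hv
    simp [hs, testerInput, hv, start]
  have hs_le : ∀ v, s v ≤ P.top := by
    intro v
    by_cases hv : v ∈ R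
    · rw [hsR v hv]
      exact Nat.mul_le_mul_right _ (code_lt hN (hlt v)).le
    · exact (hsR' v hv).le
  have phase : ∀ Δ t, 0 < Δ → ∀ seed, (P.algorithm hn B).run G ident (testerInput R H ε) seed t =
      config ident (testerInput R H ε) seed (fun v => .flood Δ 0 (s v)) →
      (P.algorithm hn B).run G ident (testerInput R H ε) seed (t + (3 * Δ + 1)) =
      config ident (testerInput R H ε) seed (fun v =>
        if (checkStep G n P.top)^[2 * Δ + 1] ((floodStep G)^[Δ] s) v = P.top then
          .flood (2 * Δ) 0 (s v)
        else .adopt Δ ((checkStep G n P.top)^[2 * Δ + 1] ((floodStep G)^[Δ] s) v)) := by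
    intro Δ t hΔ seed h
    rw [show t + (3 * Δ + 1) = t + Δ + (2 * Δ + 1) by ring]
    exact run_check htop (fun v => (flood_eq_top_or hG (code := fun v => P.code (ident v) ε)
      hsR hsR' (fun v _ => hs_le v) Δ v).1) (run_flood htop hΔ hs_le h)
  have success : ∀ Δ t r, 0 < Δ → (∀ v, (checkStep G n (P.idBound * (n + 1) * n))^[2 * Δ + 1]
      ((floodStep G)^[Δ] s) v = P.code (ident r) ε * n + G.dist v r) → ∀ seed,
      (P.algorithm hn B).run G ident (testerInput R H ε) seed t =
        config ident (testerInput R H ε) seed (fun v => .flood Δ 0 (s v)) →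
      (P.algorithm hn B).run G ident (testerInput R H ε) seed (t + (3 * Δ + 1)) =
        config ident (testerInput R H ε) seed
          (fun v => .adopt Δ (P.code (ident r) ε * n + G.dist v r)) := by
    intro Δ t r hΔ hv seed h
    rw [phase Δ t hΔ seed h]
    congr 1
    funext v
    have h1 := hv v
    have h2 : P.code (ident r) ε * n + G.dist v r < P.top := by
      have h3 : (P.code (ident r) ε + 1) * n ≤ P.idBound * (n + 1) * n :=
        Nat.mul_le_mul_right _ (code_lt hN (hlt r))
      have h4 := hG.dist_lt_of_fin v r
      rw [add_mul] at h3
      rw [top]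
      omega
    rw [show P.top = P.idBound * (n + 1) * n from rfl] at h2 ⊢
    rw [h1, if_neg h2.ne]
  -- The bound `t' + 5 * Δ ≤ t + 10 * Δ'` is the potential that survives doubling: a failed phase
  -- costs at most `4 * Δ` rounds, while `5 * Δ` grows by `5 * Δ`. The number `m` bounds the
  -- failures still to come.
  have main : ∀ m Δ t, G.diam < Δ + m → 0 < Δ → Δ ≤ 2 * G.diam →
      (∀ seed, (P.algorithm hn B).run G ident (testerInput R H ε) seed t =
        config ident (testerInput R H ε) seed (fun v => .flood Δ 0 (s v))) →
      ∃ root ∈ R, ∃ Δ' t', 0 < Δ' ∧ Δ' ≤ 2 * G.diam ∧ t' + 5 * Δ ≤ t + 10 * Δ' ∧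
        (∀ v, G.dist v root ≤ Δ') ∧
        ∀ seed, (P.algorithm hn B).run G ident (testerInput R H ε) seed t' =
          config ident (testerInput R H ε) seed
            (fun v => .adopt Δ' (P.code (ident root) ε * n + G.dist v root)) := by
    intro m
    induction m with
    | zero =>
      intro Δ t hm hΔ hΔ' h
      rcases search_dichotomy hG hsR hsR' (fun u _ v _ huv => hid (code_injective hN huv))
        (fun v _ => code_lt hN (hlt v)) hG.dist_lt_of_fin hR Δ with ⟨-, u, v, huv⟩ | ⟨r, hr, hv⟩
      · have := SimpleGraph.dist_le_diam hediam (u := u) (v := v)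
        omega
      · refine ⟨r, hr, Δ, t + (3 * Δ + 1), hΔ, hΔ', by omega, fun v => (hv v).1, fun seed => ?_⟩
        exact success Δ t r hΔ (fun v => (hv v).2) seed (h seed)
    | succ m ih =>
      intro Δ t hm hΔ hΔ' h
      rcases search_dichotomy hG hsR hsR' (fun u _ v _ huv => hid (code_injective hN huv))
        (fun v _ => code_lt hN (hlt v)) hG.dist_lt_of_fin hR Δ with ⟨hv, u, v, huv⟩ | ⟨r, hr, hv⟩
      · have h1 := SimpleGraph.dist_le_diam hediam (u := u) (v := v)
        obtain ⟨r, hr, Δ', t', h2, h3, h4, h5, h6⟩ := ih (2 * Δ) (t + (3 * Δ + 1)) (by omega)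
          (by omega) (by omega) (fun seed => by
            rw [phase Δ t hΔ seed (h seed)]
            congr 1
            funext v
            exact if_pos (hv v))
        exact ⟨r, hr, Δ', t', h2, h3, by omega, h5, h6⟩
      · refine ⟨r, hr, Δ, t + (3 * Δ + 1), hΔ, hΔ', by omega, fun v => (hv v).1, fun seed => ?_⟩
        exact success Δ t r hΔ (fun v => (hv v).2) seed (h seed)
  obtain ⟨r, hr, Δ, t, h1, h2, h3, h4, h5⟩ := main G.diam 1 0 (by omega) one_pos (by omega)
    (fun seed => rfl)
  exact ⟨r, hr, Δ, t, h1, h2, by omega, h4, h5⟩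

end Search

end TesterParams

/-! ### Pipelined summation, labels and fingerprints. -/

/-- If in every round each vertex `v` reports `o t v` plus the sum of what its children reported in
the previous round, and its reports are on schedule for its depth `d v`, then the root reports the
sum of all contributions. -/
lemma sum_level_eq_sum {V A : Type*} [Fintype V] [DecidableEq V] [AddCommMonoid A]
    {pv : V → V} {d : V → ℕ} {root : V} {child : V → V → Prop} [DecidableRel child]
    (hroot : ∀ v, d v = 0 ↔ v = root)
    (hchild : ∀ u v, child u v ↔ u ≠ root ∧ pv u = v)
    (hd : ∀ u, u ≠ root → d (pv u) + 1 = d u) {Δ : ℕ} (hΔ : ∀ v, d v ≤ Δ)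
    {o X : ℕ → V → A} (h0 : ∀ v, X 0 v = o 0 v)
    (hX : ∀ t v, X (t + 1) v = o (t + 1) v + ∑ u with child u v, X t u) {j : ℕ} {g : V → A}
    (ho : ∀ t v, t + d v = Δ + j → o t v = g v) :
    X (Δ + j) root = ∑ v, g v := by
  -- Level `Δ - i` reports its part for point `j` at time `i + j`; by then its subtrees contain
  -- everything at that depth or deeper. The induction climbs from the deepest level to the root.
  have key : ∀ i ≤ Δ, ∑ v with d v = Δ - i, X (i + j) v = ∑ v with Δ - i ≤ d v, g v := by
    intro i
    induction i with
    | zero =>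
      intro _
      have : ∀ v, Δ - 0 ≤ d v ↔ d v = Δ - 0 := fun v => by have := hΔ v; omega
      simp only [this]
      refine Finset.sum_congr rfl fun v hv => ?_
      simp only [Finset.mem_filter, Finset.mem_univ, true_and, Nat.sub_zero] at hv
      rw [zero_add]
      cases j with
      | zero => rw [h0, ho 0 v (by omega)]
      | succ j =>
        rw [hX, ho (j + 1) v (by omega), Finset.sum_eq_zero, add_zero]
        intro u hu
        simp only [Finset.mem_filter, Finset.mem_univ, true_and, hchild] at hu
        have h1 := hd u hu.1
        have h2 := hΔ u
        rw [hu.2] at h1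
        omega
    | succ i ih =>
      intro hi
      have h1 : ∑ v with d v = Δ - (i + 1), X (i + 1 + j) v =
          ∑ v with d v = Δ - (i + 1), g v +
            ∑ v with d v = Δ - (i + 1), ∑ u with child u v, X (i + j) u := by
        rw [← Finset.sum_add_distrib]
        refine Finset.sum_congr rfl fun v hv => ?_
        simp only [Finset.mem_filter, Finset.mem_univ, true_and] at hv
        rw [show i + 1 + j = i + j + 1 by ring, hX, ho _ v (by omega)]
      have h2 : ∑ v with d v = Δ - (i + 1), ∑ u with child u v, X (i + j) u =
          ∑ u with d u = Δ - i, X (i + j) u := by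
        rw [← Finset.sum_fiberwise_of_maps_to (s := Finset.univ.filter fun u => d u = Δ - i)
          (t := Finset.univ.filter fun v => d v = Δ - (i + 1)) (g := pv)]
        · refine Finset.sum_congr rfl fun v hv => Finset.sum_congr ?_ fun _ _ => rfl
          ext u
          simp only [Finset.mem_filter, Finset.mem_univ, true_and, hchild] at hv ⊢
          constructor
          · rintro ⟨hu, rfl⟩
            have := hd u hu
            exact ⟨by omega, rfl⟩
          · rintro ⟨hu, rfl⟩
            refine ⟨?_, rfl⟩
            rintro rfl
            have := (hroot u).2 rfl
            omega
        · intro u hu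
          simp only [Finset.mem_filter, Finset.mem_univ, true_and] at hu ⊢
          have h3 : u ≠ root := by
            rintro rfl
            have := (hroot u).2 rfl
            omega
          have := hd u h3
          omega
      rw [h1, h2, ih (by omega), ← Finset.sum_union]
      · congr 1
        ext v
        simp only [Finset.mem_union, Finset.mem_filter, Finset.mem_univ, true_and]
        omega
      · rw [Finset.disjoint_filter]
        intro v _ h3
        omega
  have h := key Δ le_rfl
  simpa [hroot, Finset.filter_eq'] using h

/-- The label of a vertex: the sum of the weights of its neighbours. -/
noncomputable def labelOf {V : Type*} [Fintype V] (G : SimpleGraph V) (w : V → ℕ) (v : V) : ℕ :=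
  open Classical in ∑ u with G.Adj u v, w u

/-- The contribution of a vertex to the fingerprint of a weighted graph at the point `z`. -/
noncomputable def fingerprintAt {V A : Type*} [Fintype V] [CommSemiring A] (Q : ℕ)
    (G : SimpleGraph V) (w : V → ℕ) (v : V) (z : A) : A :=
  open Classical in
  z ^ labelOf G w v * (z ^ Q ^ 2 + ∑ u with G.Adj u v, z ^ (Q * labelOf G w u))

lemma labelOf_le {V : Type*} [Fintype V] (G : SimpleGraph V) {w : V → ℕ} {W : ℕ}
    (hw : ∀ v, w v ≤ W) (v : V) : labelOf G w v ≤ Fintype.card V * W := by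
  classical
  rw [labelOf]
  refine (Finset.sum_le_card_nsmul _ _ W fun u _ => hw u).trans ?_
  rw [smul_eq_mul]
  exact Nat.mul_le_mul_right _ (Finset.card_filter_le _ _)

/-! ### Executions of the stages after the leader is found. -/

namespace TesterParams

variable {n : ℕ} {P : TesterParams n} {hn : 0 < n} {B : ℕ} {G : SimpleGraph (Fin n)}
  {ident : Fin n → ℕ} {input : Fin n → Option (SimpleGraph (Fin n) × ℝ)} {seed : Fin n → P.Seed}

lemma seedWeight_lt (N : ℕ) (s : P.Seed) : seedWeight N s < P.weightBound := by
  rw [seedWeight]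
  split_ifs
  · exact s.2.1.2
  · exact P.weightBound_pos

section Work

variable {root : Fin n} {c Δ N : ℕ}

/-- The value of a vertex when the leader is `root` and has code `c`. -/
noncomputable def valueOf (G : SimpleGraph (Fin n)) (root : Fin n) (c : ℕ) (v : Fin n) : ℕ :=
  c * n + G.dist v root

lemma valueOf_mod (hG : G.Connected) (v : Fin n) : valueOf G root c v % n = G.dist v root := by
  rw [valueOf, add_comm, Nat.add_mul_mod_self_right, Nat.mod_eq_of_lt (hG.dist_lt_of_fin v root)]

lemma sizeOf_valueOf (hG : G.Connected) (v : Fin n) :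
    sizeOf n (valueOf G root c v) = c % (n + 1) := by
  have h := hG.dist_lt_of_fin v root
  rw [sizeOf, valueOf, mul_comm, Nat.mul_add_div (by omega), Nat.div_eq_of_lt h, add_zero]

lemma exists_run_eq_weigh (hG : G.Connected) (hc : ∀ v, valueOf G root c v < n ^ B) {t : ℕ}
    (h : (P.algorithm hn B).run G ident input seed t =
      config ident input seed (fun v => .adopt Δ (valueOf G root c v))) :
    ∃ pv : Fin n → Fin n, pv root = root ∧
      (∀ v, v ≠ root → G.Adj (pv v) v ∧ G.dist (pv v) root + 1 = G.dist v root) ∧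
      (P.algorithm hn B).run G ident input seed (t + 1) =
        config ident input seed (fun v => .weigh Δ (valueOf G root c v) (ident (pv v))) := by
  have hne : ∀ v, v ≠ root → ∃ u, G.Adj u v ∧ G.dist u root + 1 = G.dist v root ∧
      sInf {i | ∃ q ∈ inbox G ident (valueOf G root c) v, q.1 = i ∧
        q.2 + 1 = valueOf G root c v} = ident u := by
    intro v hv
    have h1 := Nat.sInf_mem (s := {i | ∃ q ∈ inbox G ident (valueOf G root c) v, q.1 = i ∧
        q.2 + 1 = valueOf G root c v}) (by
      obtain ⟨u, hu, hd⟩ := hG.exists_adj_dist_add_one hv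
      exact ⟨ident u, _, ⟨u, hu, rfl⟩, rfl, by simp only [valueOf]; omega⟩)
    obtain ⟨_, ⟨u, hu, rfl⟩, hi, hd⟩ := h1
    exact ⟨u, hu, by simp only [valueOf] at hd; omega, hi.symm⟩
  choose! pv hpv using hne
  refine ⟨fun v => if v = root then root else pv v, by simp, fun v hv => ?_, ?_⟩
  · simp only [if_neg hv]
    exact ⟨(hpv v hv).1, (hpv v hv).2.1⟩
  · rw [run_succ_eq_config hn h (by simp) hc]
    congr 1
    funext v
    simp only [next, message, valueOf_mod hG]
    by_cases hv : v = root
    · simp [hv]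
    · rw [if_neg (hG.pos_dist_of_ne hv).ne', if_neg hv]
      exact congrArg _ (hpv v hv).2.2

lemma run_eq_label (hG : G.Connected) (hid : Function.Injective ident)
    (hW : P.weightBound ≤ n ^ B) (hN : c % (n + 1) = N) {par : Fin n → ℕ} {t : ℕ}
    (h : (P.algorithm hn B).run G ident input seed t =
      config ident input seed (fun v => .weigh Δ (valueOf G root c v) (par v))) :
    (P.algorithm hn B).run G ident input seed (t + 1) =
      config ident input seed (fun v => .label Δ (valueOf G root c v) (par v)
        (labelOf G (fun u => seedWeight N (seed u)) v)) := by
  classical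
  rw [run_succ_eq_config hn h (by simp) (fun v => lt_of_lt_of_le (seedWeight_lt _ _) hW)]
  congr 1
  funext v
  simp only [next, message, sizeOf_valueOf hG, hN]
  rw [finsum_inbox hid, labelOf]

lemma run_eq_spread (hG : G.Connected) (hid : Function.Injective ident)
    (hW : n * P.weightBound < n ^ B) {w : Fin n → ℕ} (hw : ∀ v, w v ≤ P.weightBound)
    {par : Fin n → ℕ} {t : ℕ}
    (h : (P.algorithm hn B).run G ident input seed t =
      config ident input seed (fun v => .label Δ (valueOf G root c v) (par v) (labelOf G w v))) :
    (P.algorithm hn B).run G ident input seed (t + 1) =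
      config ident input seed (fun v => .spread Δ (valueOf G root c v) (par v)
        (fingerprintAt (n * P.weightBound) G w v) 0
        (if v = root then seedCoin (seed v) else 0)) := by
  classical
  rw [run_succ_eq_config hn h (by simp) (fun v => by
    have := labelOf_le G hw v
    rw [Fintype.card_fin] at this
    exact this.trans_lt hW)]
  congr 1
  funext v
  simp only [next, message, valueOf_mod hG, hG.dist_eq_zero_iff]
  congr 1
  funext z
  rw [finsum_inbox hid, fingerprintAt]

lemma sInf_parent_inbox (hid : Function.Injective ident) {x : Fin n → ℕ} {u v : Fin n}
    (h : G.Adj u v) : sInf {y | (ident u, y) ∈ inbox G ident x v} = x u := by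
  have : {y | (ident u, y) ∈ inbox G ident x v} = {x u} := by
    ext y
    constructor
    · rintro ⟨u', -, hu'⟩
      rw [Prod.mk.injEq] at hu'
      rw [hid hu'.1]
      exact hu'.2
    · rintro rfl
      exact ⟨u, h, rfl⟩
  rw [this, csInf_singleton]

/-- The coins travel down the tree one edge per round: coin `j` is at depth `d` at time `d + j`.
Entries with index below the depth mean nothing, and no claim is made about them. -/
lemma exists_run_eq_collect (hG : G.Connected) (hid : Function.Injective ident)
    (hp : P.p ≤ n ^ B) (hN : c % (n + 1) = N) (hΔ : 0 < Δ) {pv : Fin n → Fin n}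
    (hpv : ∀ v, v ≠ root → G.Adj (pv v) v ∧ G.dist (pv v) root + 1 = G.dist v root)
    {fp : Fin n → ZMod P.p → ZMod P.p} {r : ℕ → ZMod P.p} {t : ℕ}
    (h : (P.algorithm hn B).run G ident input seed t =
      config ident input seed (fun v => .spread Δ (valueOf G root c v) (ident (pv v)) (fp v) 0
        (if v = root then r else 0))) :
    ∃ coin : Fin n → ℕ → ZMod P.p,
      (∀ v j, G.dist v root + j ≤ Δ + P.reps N → coin v (G.dist v root + j) = r j) ∧
      (P.algorithm hn B).run G ident input seed (t + (Δ + P.reps N)) =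
        config ident input seed (fun v => .collect Δ (valueOf G root c v) (ident (pv v)) (fp v)
          (coin v) 0 0 0) := by
  have hstep : ∀ k (coin : Fin n → ℕ → ZMod P.p),
      (P.algorithm hn B).run G ident input seed (t + k) =
        config ident input seed (fun v => .spread Δ (valueOf G root c v) (ident (pv v)) (fp v) k
          (coin v)) →
      coin root = r →
      (∀ v j, G.dist v root + j ≤ k → coin v (G.dist v root + j) = r j) →
      ∃ coin' : Fin n → ℕ → ZMod P.p, coin' root = r ∧
        (∀ v j, G.dist v root + j ≤ k + 1 → coin' v (G.dist v root + j) = r j) ∧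
        (P.algorithm hn B).run G ident input seed (t + (k + 1)) =
          config ident input seed (fun v => if k + 1 < Δ + P.reps N then
            .spread Δ (valueOf G root c v) (ident (pv v)) (fp v) (k + 1) (coin' v) else
            .collect Δ (valueOf G root c v) (ident (pv v)) (fp v) (coin' v) 0 0 0) := by
    intro k coin hk hroot hcoin
    refine ⟨fun v => if v = root then coin v else
      Function.update (coin v) (k + 1) (coin (pv v) k), by simp [hroot], ?_, ?_⟩
    · intro v j hj
      by_cases hv : v = root
      · subst hv
        simp [hroot]
      · simp only [if_neg hv]
        obtain ⟨-, hd⟩ := hpv v hv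
        by_cases hj' : G.dist v root + j = k + 1
        · rw [hj', Function.update_self, ← hcoin (pv v) j (by omega)]
          congr 1
          omega
        · rw [Function.update_of_ne hj', hcoin v j (by omega)]
    · rw [← add_assoc, run_succ_eq_config hn hk (by simp)
        (fun v => lt_of_lt_of_le (ZMod.val_lt _) hp)]
      congr 1
      funext v
      simp only [next, message, valueOf_mod hG, sizeOf_valueOf hG, hN, hG.dist_eq_zero_iff]
      by_cases hv : v = root
      · simp only [if_pos hv]
      · simp only [if_neg hv]
        rw [sInf_parent_inbox hid (hpv v hv).1, ZMod.natCast_zmod_val]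
  have hall : ∀ k < Δ + P.reps N, ∃ coin : Fin n → ℕ → ZMod P.p,
      (P.algorithm hn B).run G ident input seed (t + k) =
        config ident input seed (fun v => .spread Δ (valueOf G root c v) (ident (pv v)) (fp v) k
          (coin v)) ∧ coin root = r ∧
      (∀ v j, G.dist v root + j ≤ k → coin v (G.dist v root + j) = r j) := by
    intro k
    induction k with
    | zero =>
      intro _
      refine ⟨_, h, by simp, fun v j hj => ?_⟩
      have hv : v = root := hG.dist_eq_zero_iff.1 (by omega)
      simp [hv]
    | succ k ih =>
      intro hk
      obtain ⟨coin, h1, h2, h3⟩ := ih (by omega)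
      obtain ⟨coin', h1', h2', h3'⟩ := hstep k coin h1 h2 h3
      refine ⟨coin', ?_, h1', h2'⟩
      rw [h3']
      exact congrArg (config ident input seed) (funext fun v => if_pos hk)
  obtain ⟨coin, h1, h2, h3⟩ := hall (Δ + P.reps N - 1) (by omega)
  obtain ⟨coin', -, h2', h3'⟩ := hstep _ coin h1 h2 h3
  rw [show Δ + P.reps N - 1 + 1 = Δ + P.reps N by omega] at h2' h3'
  refine ⟨coin', h2', ?_⟩
  rw [h3']
  exact congrArg (config ident input seed) (funext fun v => if_neg (lt_irrefl _))

/-- The reports of the nodes while the fingerprints are summed up. -/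
noncomputable def reports (G : SimpleGraph (Fin n)) (root : Fin n) (c Δ : ℕ)
    (child : Fin n → Fin n → Prop) (fp : Fin n → ZMod P.p → ZMod P.p)
    (coin : Fin n → ℕ → ZMod P.p) : ℕ → Fin n → ZMod P.p
  | 0, v => report (n := n) Δ (valueOf G root c v) (fp v) (coin v) 0 0
  | t + 1, v => report (n := n) Δ (valueOf G root c v) (fp v) (coin v) (t + 1)
      (open Classical in ∑ u with child u v, reports G root c Δ child fp coin t u)

lemma exists_run_eq_done (hG : G.Connected) (hid : Function.Injective ident)
    (hlt : ∀ v, ident v < P.idBound)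
    (hp : P.idBound * P.p ≤ n ^ B) (hN : c % (n + 1) = N) (hΔ : 0 < Δ) {pv : Fin n → Fin n}
    (hroot : pv root = root)
    (hpv : ∀ v, v ≠ root → G.Adj (pv v) v ∧ G.dist (pv v) root + 1 = G.dist v root)
    {fp : Fin n → ZMod P.p → ZMod P.p} {coin : Fin n → ℕ → ZMod P.p} {t : ℕ}
    (h : (P.algorithm hn B).run G ident input seed t =
      config ident input seed (fun v => .collect Δ (valueOf G root c v) (ident (pv v)) (fp v)
        (coin v) 0 0 0)) :
    ∃ log : Fin n → ℕ → ZMod P.p,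
      (∀ v, ∀ j < Δ + P.reps N,
        log v j = reports G root c Δ (fun u v => u ≠ root ∧ pv u = v) fp coin j v) ∧
      (P.algorithm hn B).run G ident input seed (t + (Δ + P.reps N)) =
        config ident input seed (fun v => .done (conclude (ident v, input v, seed v) Δ
          (valueOf G root c v) (log v))) := by
  classical
  set X := reports G root c Δ (fun u v => u ≠ root ∧ pv u = v) fp coin with hX
  -- Division by `p` reveals the addressee and the cast to `ZMod p` the report, so exactly the
  -- reports of children are added. The root names itself as its parent, but it is not its own
  -- neighbour.
  have hacc : ∀ (y : Fin n → ZMod P.p) v,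
      (∑ᶠ q ∈ inbox G ident (fun u => ident (pv u) * P.p + (y u).val) v,
        if q.2 / P.p = ident v then (q.2 : ZMod P.p) else 0) =
      ∑ u with u ≠ root ∧ pv u = v, y u := by
    intro y v
    rw [finsum_inbox hid, ← Finset.sum_filter, Finset.filter_filter]
    have hdiv : ∀ u, (ident (pv u) * P.p + (y u).val) / P.p = ident (pv u) := by
      intro u
      rw [mul_comm, Nat.mul_add_div P.prime.pos, Nat.div_eq_of_lt (ZMod.val_lt _), add_zero]
    refine Finset.sum_congr ?_ fun u _ => ?_
    · ext u
      simp only [Finset.mem_filter, Finset.mem_univ, true_and, hdiv, hid.eq_iff]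
      constructor
      · rintro ⟨h1, h2⟩
        refine ⟨?_, h2⟩
        rintro rfl
        rw [hroot] at h2
        exact h1.ne h2
      · rintro ⟨h1, rfl⟩
        exact ⟨(hpv u h1).1.symm, rfl⟩
    · simp
  have hmsg : ∀ v (y : ZMod P.p), ident (pv v) * P.p + y.val < n ^ B := by
    intro v y
    have h1 : (ident (pv v) + 1) * P.p ≤ P.idBound * P.p := Nat.mul_le_mul_right _ (hlt _)
    have h2 := ZMod.val_lt y
    rw [add_mul] at h1
    omega
  have hstep : ∀ k (acc : Fin n → ZMod P.p) (log : Fin n → ℕ → ZMod P.p),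
      (P.algorithm hn B).run G ident input seed (t + k) =
        config ident input seed (fun v => .collect Δ (valueOf G root c v) (ident (pv v)) (fp v)
          (coin v) k (acc v) (log v)) →
      (∀ v, report (n := n) Δ (valueOf G root c v) (fp v) (coin v) k (acc v) = X k v) →
      (P.algorithm hn B).run G ident input seed (t + (k + 1)) =
        config ident input seed (fun v => if k + 1 < Δ + P.reps N then
          .collect Δ (valueOf G root c v) (ident (pv v)) (fp v) (coin v) (k + 1)
            (∑ u with u ≠ root ∧ pv u = v, X k u) (Function.update (log v) k (X k v)) else
          .done (conclude (ident v, input v, seed v) Δ (valueOf G root c v)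
            (Function.update (log v) k (X k v)))) := by
    intro k acc log hk hrep
    rw [← add_assoc, run_succ_eq_config hn hk (by simp) (fun v => hmsg v _)]
    congr 1
    funext v
    simp only [next, message, sizeOf_valueOf hG, hN, hrep, hacc]
  have hrep : ∀ k v, report (n := n) Δ (valueOf G root c v) (fp v) (coin v) (k + 1)
      (∑ u with u ≠ root ∧ pv u = v, X k u) = X (k + 1) v := by
    intro k v
    rw [hX, reports]
    congr!
  have hall : ∀ k < Δ + P.reps N, ∃ (acc : Fin n → ZMod P.p) (log : Fin n → ℕ → ZMod P.p),
      (P.algorithm hn B).run G ident input seed (t + k) =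
        config ident input seed (fun v => .collect Δ (valueOf G root c v) (ident (pv v)) (fp v)
          (coin v) k (acc v) (log v)) ∧
      (∀ v, report (n := n) Δ (valueOf G root c v) (fp v) (coin v) k (acc v) = X k v) ∧
      ∀ v, ∀ j < k, log v j = X j v := by
    intro k
    induction k with
    | zero => exact fun _ => ⟨0, 0, h, fun v => rfl, fun v j hj => absurd hj (Nat.not_lt_zero j)⟩
    | succ k ih =>
      intro hk
      obtain ⟨acc, log, h1, h2, h3⟩ := ih (by omega)
      refine ⟨fun v => ∑ u with u ≠ root ∧ pv u = v, X k u,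
        fun v => Function.update (log v) k (X k v), ?_, hrep k, fun v j hj => ?_⟩
      · rw [hstep k acc log h1 h2]
        exact congrArg (config ident input seed) (funext fun v => if_pos hk)
      · beta_reduce
        by_cases hjk : j = k
        · rw [hjk, Function.update_self]
        · rw [Function.update_of_ne hjk, h3 v j (by omega)]
  obtain ⟨acc, log, h1, h2, h3⟩ := hall (Δ + P.reps N - 1) (by omega)
  refine ⟨fun v => Function.update (log v) (Δ + P.reps N - 1) (X (Δ + P.reps N - 1) v),
    fun v j hj => ?_, ?_⟩
  · beta_reduce
    by_cases hjk : j = Δ + P.reps N - 1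
    · rw [hjk, Function.update_self]
    · rw [Function.update_of_ne hjk, h3 v j (by omega)]
  · have h4 := hstep _ acc log h1 h2
    rw [show Δ + P.reps N - 1 + 1 = Δ + P.reps N by omega] at h4
    rw [h4]
    exact congrArg (config ident input seed) (funext fun v => if_neg (lt_irrefl _))

/-- The subtraction in `coordinate` truncates only when `t + d < Δ`; such reports reach the root
before time `Δ` and do not enter the sums considered here. -/
lemma reports_root (hG : G.Connected) (hΔ : ∀ v, G.dist v root ≤ Δ) {pv : Fin n → Fin n}
    (hpv : ∀ v, v ≠ root → G.Adj (pv v) v ∧ G.dist (pv v) root + 1 = G.dist v root)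
    {fp : Fin n → ZMod P.p → ZMod P.p} {coin : Fin n → ℕ → ZMod P.p} {r : ℕ → ZMod P.p} {k : ℕ}
    (hcoin : ∀ v j, G.dist v root + j ≤ Δ + k → coin v (G.dist v root + j) = r j)
    {j : ℕ} (hj : j < k) :
    reports G root c Δ (fun u v => u ≠ root ∧ pv u = v) fp coin (Δ + j) root =
      ∑ v, fp v (r j) := by
  classical
  refine sum_level_eq_sum (d := fun v => G.dist v root) (pv := pv)
    (child := fun u v => u ≠ root ∧ pv u = v)
    (o := fun t v => fp v (coin v (G.dist v root + coordinate Δ (G.dist v root) t)))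
    (fun v => hG.dist_eq_zero_iff) (fun u v => Iff.rfl) (fun u hu => (hpv u hu).2) hΔ ?_ ?_ ?_
  · intro v
    rw [reports, report, valueOf_mod hG, add_zero]
  · intro t v
    rw [reports, report, valueOf_mod hG]
    congr!
  · intro t v ht
    have h1 : coordinate Δ (G.dist v root) t = j := by
      rw [coordinate]
      omega
    simp only [h1]
    rw [hcoin v j (by have := hΔ v; omega)]

end Work

/-- The verdicts of the tester: there is a leader that gets to know the fingerprints of the network
at the points given by its coins and decides; the other nodes accept. -/
theorem exists_leader {R : Set (Fin n)} {H : SimpleGraph (Fin n)} {ε : ℝ} (hG : G.Connected)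
    (hid : Function.Injective ident) (hlt : ∀ v, ident v < P.idBound) (htop : P.top < n ^ B)
    (hW : n * P.weightBound < n ^ B) (hp : P.idBound * P.p ≤ n ^ B) (hN : P.samples ε ≤ n)
    (hR : R.Nonempty) (hdiam : 0 < G.diam) {T : ℕ}
    (hT : 24 * G.diam + 2 * P.reps (P.samples ε) + 3 ≤ T) :
    ∃ root, ∀ seed : Fin n → P.Seed, ∃ F : ℕ → ZMod P.p,
      (∀ j < P.reps (P.samples ε), F j = ∑ v, fingerprintAt (n * P.weightBound) G
        (fun u => seedWeight (P.samples ε) (seed u)) v (seedCoin (seed root) j)) ∧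
      ∀ v, (P.algorithm hn B).verdict G ident (testerInput R H ε) seed T v =
        some (if v = root then P.decide H ε (seedCoin (seed root)) F else .accept) := by
  obtain ⟨root, hroot, Δ, t, hΔ, hΔ', ht, hdist, hrun⟩ :=
    exists_run_eq_adopt (H := H) (hn := hn) hG hid hlt htop hN hR hdiam
  -- The leader must not depend on the seed, so that its coins can later be treated as independent
  -- of the weights.
  refine ⟨root, fun seed => ?_⟩
  have hidpos : 0 < P.idBound := lt_of_le_of_lt (Nat.zero_le _) (hlt root)
  have hp' : P.p ≤ n ^ B := (Nat.le_mul_of_pos_left _ hidpos).trans hp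
  have hval : ∀ v, valueOf G root (P.code (ident root) ε) v < n ^ B := by
    intro v
    have h3 : (P.code (ident root) ε + 1) * n ≤ P.idBound * (n + 1) * n :=
      Nat.mul_le_mul_right _ (code_lt hN (hlt root))
    have h4 := hG.dist_lt_of_fin v root
    rw [add_mul] at h3
    rw [top] at htop
    rw [valueOf]
    omega
  have hsize : P.code (ident root) ε % (n + 1) = P.samples ε := by
    rw [code, add_comm, Nat.add_mul_mod_self_right, Nat.mod_eq_of_lt (by omega)]
  obtain ⟨pv, hpr, hpv, h1⟩ := exists_run_eq_weigh hG hval (hrun seed)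
  have h2 := run_eq_label hG hid ((Nat.le_mul_of_pos_left _ hn).trans hW.le) hsize h1
  have h3 := run_eq_spread hG hid hW (fun v => (seedWeight_lt _ _).le) h2
  obtain ⟨coin, hcoin, h4⟩ := exists_run_eq_collect (r := seedCoin (seed root)) hG hid hp' hsize hΔ
    hpv (by
      rw [h3]
      congr 1
      funext v
      by_cases hv : v = root
      · subst hv; rfl
      · simp only [if_neg hv])
  obtain ⟨log, hlog, h5⟩ := exists_run_eq_done hG hid hlt hp hsize hΔ hpr hpv h4
  refine ⟨fun j => log root (Δ + j), fun j hj => ?_, fun v => ?_⟩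
  · exact (hlog root _ (by omega)).trans (reports_root hG hdist hpv hcoin hj)
  · rw [verdict_eq_some_of_le hn (show _ ≤ T by omega) h5]
    simp only [conclude, valueOf_mod hG, hG.dist_eq_zero_iff]
    by_cases hv : v = root
    · subst hv
      simp [testerInput, hroot]
    · by_cases hvR : v ∈ R <;> simp [testerInput, hvR, hv]

end TesterParams

/-! ### Closeness of labelled graphs with equal block counts. -/

section Closeness

variable {V : Type*}

/-- Two `0`-`1`-matrices with the same sum on a block differ little if the first is nearly constant
on the block, in the sense that its rows and its columns differ little on average. -/
lemma block_sum_abs_sub_le {e f : V → V → ℝ} (he : ∀ u v, e u v = 0 ∨ e u v = 1)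
    (hf : ∀ u v, f u v = 0 ∨ f u v = 1) {S T : Finset V} (hS : S.Nonempty) (hT : T.Nonempty)
    (hsum : ∑ u ∈ S, ∑ v ∈ T, e u v = ∑ u ∈ S, ∑ v ∈ T, f u v) :
    ∑ u ∈ S, ∑ v ∈ T, |e u v - f u v| ≤
      4 * ((S.card : ℝ)⁻¹ * (∑ u ∈ S, ∑ u' ∈ S, ∑ v ∈ T, e u v * (1 - e u' v)) +
        (T.card : ℝ)⁻¹ * (∑ v ∈ T, ∑ v' ∈ T, ∑ u ∈ S, e u v * (1 - e u v'))) := by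
  set a := ∑ u ∈ S, ∑ v ∈ T, e u v with ha
  set s : ℝ := (S.card : ℝ) * T.card with hs
  have hSc : (0 : ℝ) < S.card := by exact_mod_cast hS.card_pos
  have hTc : (0 : ℝ) < T.card := by exact_mod_cast hT.card_pos
  have hspos : 0 < s := mul_pos hSc hTc
  have hone : ∑ u ∈ S, ∑ v ∈ T, (1 : ℝ) = s := by simp [hs]
  have ha0 : 0 ≤ a := Finset.sum_nonneg fun u _ => Finset.sum_nonneg fun v _ => by
    rcases he u v with h | h <;> norm_num [h]
  have has : a ≤ s := by
    rw [← hone]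
    refine Finset.sum_le_sum fun u _ => Finset.sum_le_sum fun v _ => ?_
    rcases he u v with h | h <;> norm_num [h]
  set m := ∑ u ∈ S, ∑ v ∈ T, |e u v - f u v| with hm
  have hm1 : m ≤ 2 * a := by
    have : m ≤ ∑ u ∈ S, ∑ v ∈ T, (e u v + f u v) := by
      refine Finset.sum_le_sum fun u _ => Finset.sum_le_sum fun v _ => ?_
      rcases he u v with h | h <;> rcases hf u v with h' | h' <;> rw [h, h'] <;> norm_num
    simp only [Finset.sum_add_distrib] at this
    linarith
  have hm2 : m ≤ 2 * (s - a) := by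
    have : m ≤ ∑ u ∈ S, ∑ v ∈ T, ((1 - e u v) + (1 - f u v)) := by
      refine Finset.sum_le_sum fun u _ => Finset.sum_le_sum fun v _ => ?_
      rcases he u v with h | h <;> rcases hf u v with h' | h' <;> rw [h, h'] <;> norm_num
    simp only [Finset.sum_add_distrib, Finset.sum_sub_distrib, hone] at this
    linarith
  -- Write `m * s = m * a + m * (s - a)` and use the bounds `2 * (s - a)` and `2 * a` for `m` in the
  -- two terms.
  have hms : m * s ≤ 4 * (a * (s - a)) := by
    nlinarith [mul_le_mul_of_nonneg_left hm2 ha0, mul_le_mul_of_nonneg_left hm1 (sub_nonneg.2 has)]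
  have hquad : a * (s - a) =
      ∑ u ∈ S, ∑ v ∈ T, ∑ u' ∈ S, ∑ v' ∈ T, e u v * (1 - e u' v') := by
    have : s - a = ∑ u' ∈ S, ∑ v' ∈ T, (1 - e u' v') := by
      simp only [Finset.sum_sub_distrib, hone, ha]
    rw [this, ha, Finset.sum_mul]
    refine Finset.sum_congr rfl fun u _ => ?_
    rw [Finset.sum_mul]
    refine Finset.sum_congr rfl fun v _ => ?_
    rw [Finset.mul_sum]
    exact Finset.sum_congr rfl fun u' _ => Finset.mul_sum _ _ _
  -- A 1 at `(u, v)` and a 0 at `(u', v')` are compared through the entry `(u', v)`: if it is 0,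
  -- rows `u` and `u'` differ at `v`; if it is 1, columns `v` and `v'` differ at `u'`.
  have hsplit : ∑ u ∈ S, ∑ v ∈ T, ∑ u' ∈ S, ∑ v' ∈ T, e u v * (1 - e u' v') ≤
      T.card * (∑ u ∈ S, ∑ u' ∈ S, ∑ v ∈ T, e u v * (1 - e u' v)) +
        S.card * (∑ v ∈ T, ∑ v' ∈ T, ∑ u ∈ S, e u v * (1 - e u v')) := by
    have h1 : ∑ u ∈ S, ∑ v ∈ T, ∑ u' ∈ S, ∑ v' ∈ T, e u v * (1 - e u' v') ≤
        ∑ u ∈ S, ∑ v ∈ T, ∑ u' ∈ S, ∑ v' ∈ T,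
          (e u v * (1 - e u' v) + e u' v * (1 - e u' v')) := by
      refine Finset.sum_le_sum fun u _ => Finset.sum_le_sum fun v _ =>
        Finset.sum_le_sum fun u' _ => Finset.sum_le_sum fun v' _ => ?_
      rcases he u v with h | h <;> rcases he u' v with h' | h' <;>
        rcases he u' v' with h'' | h'' <;> rw [h, h', h''] <;> norm_num
    refine h1.trans_eq ?_
    simp only [Finset.sum_add_distrib, Finset.sum_const, nsmul_eq_mul, Finset.mul_sum]
    congr 1
    · refine Finset.sum_congr rfl fun u _ => Finset.sum_comm
    · refine Finset.sum_congr rfl fun v _ => ?_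
      rw [Finset.sum_comm]
  have hfin : m * s ≤ s * (4 * ((S.card : ℝ)⁻¹ * (∑ u ∈ S, ∑ u' ∈ S, ∑ v ∈ T,
      e u v * (1 - e u' v)) +
        (T.card : ℝ)⁻¹ * (∑ v ∈ T, ∑ v' ∈ T, ∑ u ∈ S, e u v * (1 - e u v')))) := by
    refine hms.trans ?_
    rw [hquad]
    refine (mul_le_mul_of_nonneg_left hsplit (by norm_num)).trans_eq ?_
    rw [hs]
    field_simp
  rw [mul_comm m s] at hfin
  exact le_of_mul_le_mul_left hfin hspos

variable [Fintype V]

-- In the sum over all blocks, dividing by the class size averages over the vertices of equal label,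
-- which leaves at most `K` per vertex for the rows. By symmetry of `e` the columns give the same,
-- hence `4 * (K + K)` per vertex.
open Classical in
lemma sum_abs_sub_le_of_label {e f : V → V → ℝ} (he : ∀ u v, e u v = 0 ∨ e u v = 1)
    (hf : ∀ u v, f u v = 0 ∨ f u v = 1) (hsymm : ∀ u v, e u v = e v u) {label : V → ℕ} {K : ℝ}
    (hK : ∀ u u', label u = label u' → ∑ v, e u v * (1 - e u' v) ≤ K)
    (hsum : ∀ i j, ∑ u with label u = i, ∑ v with label v = j, e u v =
      ∑ u with label u = i, ∑ v with label v = j, f u v) :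
    ∑ u, ∑ v, |e u v - f u v| ≤ 8 * (K * Fintype.card V) := by
  set C : ℕ → Finset V := fun i => Finset.univ.filter fun u => label u = i with hC
  set I : Finset ℕ := Finset.univ.image label with hI
  have hmaps : ∀ u ∈ (Finset.univ : Finset V), label u ∈ I := fun u _ =>
    Finset.mem_image_of_mem _ (Finset.mem_univ u)
  have fib : ∀ g : V → ℝ, ∑ i ∈ I, ∑ u ∈ C i, g u = ∑ u, g u := fun g =>
    Finset.sum_fiberwise_of_maps_to hmaps g
  have hne : ∀ i ∈ I, (C i).Nonempty := by
    intro i hi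
    obtain ⟨u, -, hu⟩ := Finset.mem_image.1 hi
    exact ⟨u, by simp [hC, hu]⟩
  have half : ∑ i ∈ I, ∑ j ∈ I, ((C i).card : ℝ)⁻¹ *
      (∑ u ∈ C i, ∑ u' ∈ C i, ∑ v ∈ C j, e u v * (1 - e u' v)) ≤ K * Fintype.card V := by
    calc ∑ i ∈ I, ∑ j ∈ I, ((C i).card : ℝ)⁻¹ *
        (∑ u ∈ C i, ∑ u' ∈ C i, ∑ v ∈ C j, e u v * (1 - e u' v))
        = ∑ i ∈ I, ((C i).card : ℝ)⁻¹ * ∑ u ∈ C i, ∑ u' ∈ C i, ∑ v, e u v * (1 - e u' v) := by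
          refine Finset.sum_congr rfl fun i _ => ?_
          rw [← Finset.mul_sum, Finset.sum_comm]
          congr 1
          refine Finset.sum_congr rfl fun u _ => ?_
          rw [Finset.sum_comm]
          exact Finset.sum_congr rfl fun u' _ => fib _
      _ ≤ ∑ i ∈ I, ((C i).card : ℝ)⁻¹ * ∑ u ∈ C i, ∑ u' ∈ C i, K := by
          refine Finset.sum_le_sum fun i _ => mul_le_mul_of_nonneg_left
            (Finset.sum_le_sum fun u hu => Finset.sum_le_sum fun u' hu' => hK u u' ?_)
            (by positivity)
          simp only [hC, Finset.mem_filter, Finset.mem_univ, true_and] at hu hu'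
          rw [hu, hu']
      _ = ∑ i ∈ I, ∑ u ∈ C i, K := by
          refine Finset.sum_congr rfl fun i hi => ?_
          have : ((C i).card : ℝ) ≠ 0 := by exact_mod_cast (hne i hi).card_pos.ne'
          simp only [Finset.sum_const, nsmul_eq_mul]
          field_simp
      _ = K * Fintype.card V := by
          rw [fib]
          simp [mul_comm]
  calc ∑ u, ∑ v, |e u v - f u v|
      = ∑ i ∈ I, ∑ j ∈ I, ∑ u ∈ C i, ∑ v ∈ C j, |e u v - f u v| := by
        rw [← fib]
        refine Finset.sum_congr rfl fun i _ => ?_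
        refine Eq.trans ?_ Finset.sum_comm
        exact Finset.sum_congr rfl fun u _ => (fib _).symm
    _ ≤ ∑ i ∈ I, ∑ j ∈ I, 4 * (((C i).card : ℝ)⁻¹ *
          (∑ u ∈ C i, ∑ u' ∈ C i, ∑ v ∈ C j, e u v * (1 - e u' v)) +
        ((C j).card : ℝ)⁻¹ * (∑ v ∈ C j, ∑ v' ∈ C j, ∑ u ∈ C i, e u v * (1 - e u v'))) :=
        Finset.sum_le_sum fun i hi => Finset.sum_le_sum fun j hj =>
          block_sum_abs_sub_le he hf (hne i hi) (hne j hj) (hsum i j)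
    _ = 4 * (∑ i ∈ I, ∑ j ∈ I, ((C i).card : ℝ)⁻¹ *
          (∑ u ∈ C i, ∑ u' ∈ C i, ∑ v ∈ C j, e u v * (1 - e u' v)) +
        ∑ j ∈ I, ∑ i ∈ I, ((C j).card : ℝ)⁻¹ *
          (∑ v ∈ C j, ∑ v' ∈ C j, ∑ u ∈ C i, e v u * (1 - e v' u))) := by
        simp only [← Finset.mul_sum, Finset.sum_add_distrib]
        congr 2
        rw [Finset.sum_comm]
        refine Finset.sum_congr rfl fun j _ => ?_
        rw [Finset.mul_sum]
        refine Finset.sum_congr rfl fun i _ => ?_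
        congr 1
        refine Finset.sum_congr rfl fun v _ => Finset.sum_congr rfl fun v' _ =>
          Finset.sum_congr rfl fun u _ => ?_
        rw [hsymm u v, hsymm u v']
    _ ≤ 8 * (K * Fintype.card V) := by linarith

end Closeness

section Relabel

variable {V W : Type} [Fintype V] [Fintype W]

lemma exists_equiv_of_card_fiber_eq {ι : Type*} [DecidableEq ι] {a : V → ι} {b : W → ι}
    (h : ∀ i, (Finset.univ.filter fun v => a v = i).card =
      (Finset.univ.filter fun w => b w = i).card) :
    ∃ π : V ≃ W, ∀ v, b (π v) = a v := by
  have e : ∀ i, Nonempty ({v // a v = i} ≃ {w // b w = i}) := fun i =>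
    Fintype.card_eq.1 (by rw [Fintype.card_subtype, Fintype.card_subtype, h i])
  exact ⟨Equiv.ofFiberEquiv fun i => (e i).some, fun v => Equiv.ofFiberEquiv_map _ v⟩

open Classical in
lemma ncard_symmDiff_edgeSet_le (G G' : SimpleGraph V) :
    (symmDiff G.edgeSet G'.edgeSet).ncard ≤
      (Finset.univ.filter fun q : V × V => ¬(G.Adj q.1 q.2 ↔ G'.Adj q.1 q.2)).card := by
  have hsub : symmDiff G.edgeSet G'.edgeSet ⊆ (fun q : V × V => s(q.1, q.2)) ''
      ((Finset.univ.filter fun q : V × V => ¬(G.Adj q.1 q.2 ↔ G'.Adj q.1 q.2) :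
        Finset (V × V)) : Set (V × V)) := by
    intro z hz
    induction z with
    | _ u v =>
      refine ⟨(u, v), ?_, rfl⟩
      simp only [Set.mem_symmDiff, SimpleGraph.mem_edgeSet] at hz
      simp only [Finset.coe_filter, Finset.mem_univ, true_and, Set.mem_ofPred_eq]
      tauto
  refine (Set.ncard_le_ncard hsub (Set.toFinite _)).trans ?_
  refine (Set.ncard_image_le (Set.toFinite _)).trans ?_
  rw [Set.ncard_coe_finset]

open Classical in
/-- If two labelled graphs have the same numbers of vertices of each label and of edges between each
two labels, and if vertices of the first graph with the same label have nearly the same neighbours,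
then the first graph is close to being isomorphic to the second. -/
theorem exists_iso_close {G : SimpleGraph V} {H : SimpleGraph W} {a : V → ℕ} {b : W → ℕ} {K : ℝ}
    (hK : ∀ u u', a u = a u' →
      ((Finset.univ.filter fun v => G.Adj u v ∧ ¬ G.Adj u' v).card : ℝ) ≤ K)
    (hcard : ∀ i, (Finset.univ.filter fun v => a v = i).card =
      (Finset.univ.filter fun w => b w = i).card)
    (hedge : ∀ i j, (Finset.univ.filter fun q : V × V => G.Adj q.1 q.2 ∧ a q.1 = i ∧ a q.2 = j).card
      = (Finset.univ.filter fun q : W × W => H.Adj q.1 q.2 ∧ b q.1 = i ∧ b q.2 = j).card) :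
    ∃ G' : SimpleGraph V, Nonempty (G' ≃g H) ∧
      ((symmDiff G.edgeSet G'.edgeSet).ncard : ℝ) ≤ 8 * (K * Fintype.card V) := by
  obtain ⟨π, hπ⟩ := exists_equiv_of_card_fiber_eq hcard
  -- Any label-preserving bijection will do: only the block sums enter the estimate.
  refine ⟨H.comap π, ⟨SimpleGraph.Iso.comap π H⟩, ?_⟩
  have key := sum_abs_sub_le_of_label (e := fun u v => if G.Adj u v then 1 else 0)
    (f := fun u v => if H.Adj (π u) (π v) then 1 else 0) (label := a) (K := K)
    (fun u v => by by_cases h : G.Adj u v <;> simp [h])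
    (fun u v => by by_cases h : H.Adj (π u) (π v) <;> simp [h])
    (fun u v => by simp only [G.adj_comm]) (fun u u' huu => by
      refine le_trans (le_of_eq ?_) (hK u u' huu)
      rw [Finset.card_filter]
      push_cast
      refine Finset.sum_congr rfl fun v _ => ?_
      by_cases h : G.Adj u v <;> by_cases h' : G.Adj u' v <;> simp [h, h']) (fun i j => by
      have h1 : ∀ p : V → V → Prop, (∑ u with a u = i, ∑ v with a v = j,
          (if p u v then 1 else 0 : ℝ)) =
          ((Finset.univ.filter fun q : V × V => p q.1 q.2 ∧ a q.1 = i ∧ a q.2 = j).card : ℝ) := by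
        intro p
        rw [← Finset.sum_product', Finset.sum_boole]
        congr 2
        ext q
        simp only [Finset.mem_filter, Finset.mem_product, Finset.mem_univ, true_and]
        tauto
      rw [h1, h1, hedge i j]
      norm_cast
      refine (Finset.card_bij' (fun q _ => (π q.1, π q.2)) (fun q _ => (π.symm q.1, π.symm q.2))
        ?_ ?_ ?_ ?_).symm
      · rintro ⟨u, v⟩ h
        simpa [hπ] using h
      · rintro ⟨u, v⟩ h
        simpa [← hπ] using h
      · rintro ⟨u, v⟩ _
        simp
      · rintro ⟨u, v⟩ _
        simp)
  refine le_trans ?_ key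
  have h1 := ncard_symmDiff_edgeSet_le G (H.comap π)
  have h2 : ((symmDiff G.edgeSet (H.comap π).edgeSet).ncard : ℝ) ≤
      ((Finset.univ.filter fun q : V × V =>
        ¬(G.Adj q.1 q.2 ↔ (H.comap π).Adj q.1 q.2)).card : ℝ) := by exact_mod_cast h1
  refine h2.trans (le_of_eq ?_)
  rw [← Finset.sum_product', Finset.card_filter, Finset.univ_product_univ]
  push_cast
  refine Finset.sum_congr rfl fun q _ => ?_
  by_cases h : G.Adj q.1 q.2 <;> by_cases h' : H.Adj (π q.1) (π q.2) <;> simp [h, h']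

end Relabel

/-! ### Fingerprint polynomials. -/

section Fingerprint

open Polynomial

variable {V W : Type} [Fintype V] [Fintype W]

/-- The fingerprint of a weighted graph at the point `z`. -/
noncomputable def fingerprint {A : Type*} [CommSemiring A] (Q : ℕ) (G : SimpleGraph V)
    (w : V → ℕ) (z : A) : A :=
  ∑ v, fingerprintAt Q G w v z

lemma map_fingerprint {A B : Type*} [CommSemiring A] [CommSemiring B] (φ : A →+* B) (Q : ℕ)
    (G : SimpleGraph V) (w : V → ℕ) (z : A) :
    φ (fingerprint Q G w z) = fingerprint Q G w (φ z) := by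
  simp [fingerprint, fingerprintAt, map_sum]

lemma eval_fingerprint {A : Type*} [CommSemiring A] (Q : ℕ) (G : SimpleGraph V) (w : V → ℕ)
    (z : A) : (fingerprint Q G w (X : A[X])).eval z = fingerprint Q G w z := by
  have := map_fingerprint (Polynomial.evalRingHom z) Q G w X
  simpa using this

lemma labelOf_iso {G : SimpleGraph V} {H : SimpleGraph W} (φ : G ≃g H) (w : V → ℕ) (v : V) :
    labelOf H (fun x => w (φ.symm x)) (φ v) = labelOf G w v := by
  classical
  rw [labelOf, labelOf, Finset.sum_filter, Finset.sum_filter]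
  rw [← Equiv.sum_comp φ.toEquiv]
  refine Finset.sum_congr rfl fun u _ => ?_
  simp [φ.map_adj_iff]

lemma fingerprint_iso {A : Type*} [CommSemiring A] {G : SimpleGraph V} {H : SimpleGraph W}
    (φ : G ≃g H) (Q : ℕ) (w : V → ℕ) (z : A) :
    fingerprint Q H (fun x => w (φ.symm x)) z = fingerprint Q G w z := by
  classical
  rw [fingerprint, fingerprint, ← Equiv.sum_comp φ.toEquiv]
  refine Finset.sum_congr rfl fun v _ => ?_
  have h1 : ∀ u, labelOf H (fun x => w (φ.symm x)) (φ u) = labelOf G w u := labelOf_iso φ w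
  rw [fingerprintAt, fingerprintAt, Finset.sum_filter, Finset.sum_filter,
    ← Equiv.sum_comp φ.toEquiv]
  simp only [RelIso.coe_fn_toEquiv, h1, φ.map_adj_iff]

/-- For labels below `Q`, an ordered edge contributes a two-digit number in base `Q`, hence an
exponent below `Q ^ 2`, and a vertex an exponent from `Q ^ 2` on. The two kinds of monomials do not
mix, and each coefficient is a single count. -/
lemma fingerprint_X_eq {A : Type*} [CommSemiring A] (Q : ℕ) (G : SimpleGraph V)
    [DecidableRel G.Adj] (w : V → ℕ) :
    fingerprint Q G w (X : A[X]) = ∑ v, X ^ (labelOf G w v + Q ^ 2) +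
      ∑ q : V × V with G.Adj q.1 q.2, X ^ (labelOf G w q.1 + Q * labelOf G w q.2) := by
  classical
  simp only [fingerprint, fingerprintAt, mul_add, Finset.sum_add_distrib, ← pow_add,
    Finset.mul_sum]
  congr 1
  rw [Finset.sum_filter, Fintype.sum_prod_type]
  refine Finset.sum_congr rfl fun v _ => ?_
  rw [Finset.sum_filter]
  refine Finset.sum_congr rfl fun u _ => ?_
  simp only [G.adj_comm u v]

lemma coeff_fingerprint {A : Type*} [CommSemiring A] (Q : ℕ) (G : SimpleGraph V)
    [DecidableRel G.Adj] (w : V → ℕ) (m : ℕ) :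
    (fingerprint Q G w (X : A[X])).coeff m =
      (((Finset.univ.filter fun v => labelOf G w v + Q ^ 2 = m).card +
        (Finset.univ.filter fun q : V × V => G.Adj q.1 q.2 ∧
          labelOf G w q.1 + Q * labelOf G w q.2 = m).card : ℕ) : A) := by
  rw [fingerprint_X_eq, coeff_add, finsetSum_coeff, finsetSum_coeff]
  simp only [coeff_X_pow, eq_comm (a := m), Finset.sum_boole, Finset.filter_filter]
  push_cast
  rfl

lemma natDegree_fingerprint_le {A : Type*} [CommSemiring A] {Q : ℕ} {G : SimpleGraph V}
    {w : V → ℕ} (hQ : ∀ v, labelOf G w v < Q) :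
    (fingerprint Q G w (X : A[X])).natDegree ≤ 2 * Q ^ 2 := by
  classical
  rw [fingerprint_X_eq]
  have h : ∀ a b, a < Q → b < Q → a + Q * b < Q ^ 2 := by
    intro a b ha hb
    nlinarith [Nat.mul_le_mul_left Q (Nat.succ_le_of_lt hb)]
  refine (natDegree_add_le _ _).trans (max_le ?_ ?_) <;>
  · refine natDegree_sum_le_of_forall_le _ _ fun v _ => (natDegree_X_pow_le _).trans ?_
    first
    | have := h _ 0 (hQ v) (by have := hQ v; omega)
      omega
    | have := h _ _ (hQ v.1) (hQ v.2)
      omega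

open Classical in
/-- The fingerprint polynomial determines the numbers of vertices of each label and of edges between
each two labels. -/
lemma card_eq_of_fingerprint_eq {p Q : ℕ} {G : SimpleGraph V}
    {H : SimpleGraph W} {w : V → ℕ} {w' : W → ℕ} (hQ : ∀ v, labelOf G w v < Q)
    (hQ' : ∀ v, labelOf H w' v < Q) (hpV : Fintype.card V ^ 2 < p)
    (hpW : Fintype.card W ^ 2 < p)
    (h : fingerprint Q G w (X : (ZMod p)[X]) = fingerprint Q H w' X) :
    (∀ i, (Finset.univ.filter fun v => labelOf G w v = i).card =
      (Finset.univ.filter fun v => labelOf H w' v = i).card) ∧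
    ∀ i j, (Finset.univ.filter fun q : V × V => G.Adj q.1 q.2 ∧ labelOf G w q.1 = i ∧
        labelOf G w q.2 = j).card =
      (Finset.univ.filter fun q : W × W => H.Adj q.1 q.2 ∧ labelOf H w' q.1 = i ∧
        labelOf H w' q.2 = j).card := by
  have hlt : ∀ a b, a < Q → b < Q → a + Q * b < Q ^ 2 := by
    intro a b ha hb
    nlinarith [Nat.mul_le_mul_left Q (Nat.succ_le_of_lt hb)]
  have hcoeff := fun m => congrArg (fun F => F.coeff m) h
  simp only [coeff_fingerprint] at hcoeff
  have cast_inj : ∀ a b : ℕ, a < p → b < p → (a : ZMod p) = b → a = b := by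
    intro a b ha hb hab
    rw [ZMod.natCast_eq_natCast_iff', Nat.mod_eq_of_lt ha, Nat.mod_eq_of_lt hb] at hab
    exact hab
  constructor
  · intro i
    by_cases hi : i < Q
    · have hm := hcoeff (i + Q ^ 2)
      rw [Finset.filter_false_of_mem (s := (Finset.univ : Finset (V × V)))
        (fun q _ hq => by have := hlt _ _ (hQ q.1) (hQ q.2); omega),
        Finset.filter_false_of_mem (s := (Finset.univ : Finset (W × W)))
        (fun q _ hq => by have := hlt _ _ (hQ' q.1) (hQ' q.2); omega)] at hm
      simp only [add_left_inj, Finset.card_empty, add_zero] at hm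
      refine cast_inj _ _ ?_ ?_ hm
      · exact ((Finset.card_filter_le _ _).trans (Nat.le_self_pow two_ne_zero _)).trans_lt hpV
      · exact ((Finset.card_filter_le _ _).trans (Nat.le_self_pow two_ne_zero _)).trans_lt hpW
    · rw [Finset.filter_false_of_mem (fun v _ hv => hi (by rw [← hv]; exact hQ v)),
        Finset.filter_false_of_mem (fun v _ hv => hi (by rw [← hv]; exact hQ' v)),
        Finset.card_empty, Finset.card_empty]
  · intro i j
    by_cases hij : i < Q ∧ j < Q
    · have hm := hcoeff (i + Q * j)
      have hijlt := hlt i j hij.1 hij.2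
      have hdec : ∀ a b, a < Q → (a + Q * b = i + Q * j ↔ a = i ∧ b = j) := by
        intro a b ha
        constructor
        · intro hab
          have h1 := congrArg (· % Q) hab
          simp only [Nat.add_mul_mod_self_left, Nat.mod_eq_of_lt ha, Nat.mod_eq_of_lt hij.1] at h1
          refine ⟨h1, Nat.eq_of_mul_eq_mul_left (by omega : 0 < Q) (by omega)⟩
        · rintro ⟨rfl, rfl⟩
          rfl
      rw [Finset.filter_false_of_mem (s := (Finset.univ : Finset V)) (fun v _ hv => by omega),
        Finset.filter_false_of_mem (s := (Finset.univ : Finset W)) (fun v _ hv => by omega)] at hm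
      simp only [Finset.card_empty, zero_add, hdec _ _ (hQ _), hdec _ _ (hQ' _)] at hm
      refine cast_inj _ _ ?_ ?_ hm
      · refine (Finset.card_filter_le _ _).trans_lt ?_
        rwa [Finset.card_univ, Fintype.card_prod, ← pow_two]
      · refine (Finset.card_filter_le _ _).trans_lt ?_
        rwa [Finset.card_univ, Fintype.card_prod, ← pow_two]
    · rw [Finset.filter_false_of_mem (fun q _ hq => hij (by
          rw [← hq.2.1, ← hq.2.2]; exact ⟨hQ _, hQ _⟩)),
        Finset.filter_false_of_mem (fun q _ hq => hij (by
          rw [← hq.2.1, ← hq.2.2]; exact ⟨hQ' _, hQ' _⟩)),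
        Finset.card_empty, Finset.card_empty]

/-- Two different fingerprint polynomials agree at few points. -/
lemma card_fingerprint_eq_le {p : ℕ} [Fact p.Prime] {Q : ℕ} {G : SimpleGraph V}
    {H : SimpleGraph W} {w : V → ℕ} {w' : W → ℕ} (hQ : ∀ v, labelOf G w v < Q)
    (hQ' : ∀ v, labelOf H w' v < Q)
    (h : fingerprint Q G w (X : (ZMod p)[X]) ≠ fingerprint Q H w' X) :
    (Finset.univ.filter fun z : ZMod p => fingerprint Q G w z = fingerprint Q H w' z).card ≤
      2 * Q ^ 2 := by
  set F : (ZMod p)[X] := fingerprint Q G w X - fingerprint Q H w' X with hF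
  have hF0 : F ≠ 0 := sub_ne_zero.2 h
  have hsub : (Finset.univ.filter fun z : ZMod p =>
      fingerprint Q G w z = fingerprint Q H w' z) ⊆ F.roots.toFinset := by
    intro z hz
    rw [Finset.mem_filter] at hz
    rw [Multiset.mem_toFinset, mem_roots hF0, IsRoot, hF, eval_sub, eval_fingerprint,
      eval_fingerprint, hz.2, sub_self]
  refine (Finset.card_le_card hsub).trans ((Multiset.toFinset_card_le _).trans ?_)
  refine (card_roots' F).trans ((natDegree_sub_le _ _).trans (max_le ?_ ?_))
  · exact natDegree_fingerprint_le hQ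
  · exact natDegree_fingerprint_le hQ'

end Fingerprint

/-! ### Uniform probability on finite types and on seeds. -/

/-- The probability of an event under the uniform distribution on a finite type. -/
noncomputable def unifProb {Ω : Type*} (E : Set Ω) : ℝ := (E.ncard : ℝ) / (Nat.card Ω : ℝ)

section UnifProb

lemma unifProb_union_le {Ω : Type*} (E F : Set Ω) : unifProb (E ∪ F) ≤ unifProb E + unifProb F := by
  rw [unifProb, unifProb, unifProb, ← add_div]
  gcongr
  exact_mod_cast Set.ncard_union_le E F

lemma unifProb_exists_le {Ω ι : Type*} [Fintype ι] {E : ι → Set Ω} {q : ℝ}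
    (h : ∀ i, unifProb (E i) ≤ q) : unifProb {ω | ∃ i, ω ∈ E i} ≤ Fintype.card ι * q := by
  classical
  have key : ∀ s : Finset ι, unifProb {ω | ∃ i ∈ s, ω ∈ E i} ≤ s.card * q := by
    intro s
    induction s using Finset.induction_on with
    | empty => simp [unifProb]
    | insert i s hi ih =>
      have : {ω | ∃ j ∈ insert i s, ω ∈ E j} = E i ∪ {ω | ∃ j ∈ s, ω ∈ E j} := by
        ext ω
        simp
      rw [this, Finset.card_insert_of_notMem hi]
      push_cast
      linarith [unifProb_union_le (E i) {ω | ∃ j ∈ s, ω ∈ E j}, h i]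
  simpa using key Finset.univ

variable {Ω α β : Type*} [Finite Ω] [Finite α] [Finite β]

lemma unifProb_mono {E F : Set Ω} (h : E ⊆ F) : unifProb E ≤ unifProb F := by
  rw [unifProb, unifProb]
  gcongr
  exact Set.toFinite _

lemma one_sub_unifProb_compl [Nonempty Ω] (E : Set Ω) : 1 - unifProb Eᶜ = unifProb E := by
  have h := Set.ncard_add_ncard_compl E
  have h' : (Nat.card Ω : ℝ) ≠ 0 := by exact_mod_cast Nat.card_pos.ne'
  rw [unifProb, unifProb]
  field_simp
  rw [← h]
  push_cast
  ring

/-- Conditioning on one component: a bound valid for each of its values survives averaging. -/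
lemma unifProb_le_of_fiber [Nonempty β] (e : Ω ≃ α × β) {E : Set Ω} {q : ℝ} (hq : 0 ≤ q)
    (h : ∀ a, unifProb {b | e.symm (a, b) ∈ E} ≤ q) : unifProb E ≤ q := by
  classical
  have := Fintype.ofFinite Ω
  have := Fintype.ofFinite α
  have := Fintype.ofFinite β
  have hE : E.ncard = ∑ a, {b | e.symm (a, b) ∈ E}.ncard := by
    have h1 : E.ncard = (Finset.univ.filter fun x : α × β => e.symm x ∈ E).card := by
      rw [Set.ncard_eq_toFinset_card' E]
      refine Finset.card_equiv e fun ω => ?_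
      simp
    rw [h1, Finset.card_filter, Fintype.sum_prod_type]
    refine Finset.sum_congr rfl fun a _ => ?_
    rw [← Finset.card_filter, Set.ncard_eq_toFinset_card']
    congr 1
    ext b
    simp
  have hβ : (0 : ℝ) < Nat.card β := by exact_mod_cast Nat.card_pos
  have hcard : Nat.card Ω = Nat.card α * Nat.card β := by
    rw [Nat.card_congr e, Nat.card_prod]
  rw [unifProb, hE, hcard]
  push_cast
  refine div_le_of_le_mul₀ (by positivity) hq ?_
  have h2 : ∀ a, ({b | e.symm (a, b) ∈ E}.ncard : ℝ) ≤ q * Nat.card β := by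
    intro a
    have := h a
    rwa [unifProb, div_le_iff₀ hβ] at this
  refine (Finset.sum_le_sum fun a _ => h2 a).trans_eq ?_
  simp only [Finset.sum_const, nsmul_eq_mul, Finset.card_univ, Nat.card_eq_fintype_card]
  ring

lemma unifProb_le_inv_card {E : Set Ω} (h : E.Subsingleton) :
    unifProb E ≤ (Nat.card Ω : ℝ)⁻¹ := by
  rw [unifProb, div_eq_mul_inv]
  refine mul_le_of_le_one_left (by positivity) ?_
  exact_mod_cast Set.ncard_le_one_iff_subsingleton.2 h

lemma unifProb_pi {ι : Type*} [Fintype ι] [DecidableEq ι] {γ : Type*} [Fintype γ] [DecidableEq γ]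
    (s : ι → Finset γ) :
    unifProb {f : ι → γ | ∀ i, f i ∈ s i} = ∏ i, ((s i).card / Fintype.card γ : ℝ) := by
  have : {f : ι → γ | ∀ i, f i ∈ s i} = ((Fintype.piFinset s : Finset (ι → γ)) :
      Set (ι → γ)) := by
    ext f
    simp
  rw [unifProb, this, Set.ncard_coe_finset, Fintype.card_piFinset, Nat.card_eq_fintype_card,
    Fintype.card_fun, Finset.prod_div_distrib]
  simp

lemma unifProb_pi_subset {ι : Type*} [Fintype ι] [DecidableEq ι] {γ : Type*} [Fintype γ]
    [Nonempty γ] [DecidableEq γ] (D : Finset ι) (s : Finset γ) :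
    unifProb {f : ι → γ | ∀ i ∈ D, f i ∈ s} = (s.card / Fintype.card γ : ℝ) ^ D.card := by
  have h := unifProb_pi (fun i => if i ∈ D then s else (Finset.univ : Finset γ))
  have h1 : {f : ι → γ | ∀ i, f i ∈ if i ∈ D then s else (Finset.univ : Finset γ)} =
      {f : ι → γ | ∀ i ∈ D, f i ∈ s} := by
    ext f
    refine forall_congr' fun i => ?_
    by_cases hi : i ∈ D <;> simp [hi]
  rw [h1] at h
  rw [h, ← Finset.prod_const]
  have hγ : (Fintype.card γ : ℝ) ≠ 0 := by exact_mod_cast Fintype.card_ne_zero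
  rw [← Finset.prod_subset (Finset.subset_univ D)]
  · exact Finset.prod_congr rfl fun i hi => by rw [if_pos hi]
  · intro i _ hi
    rw [if_neg hi, Finset.card_univ, div_self hγ]

/-- A tail bound for the number of successes in independent trials. -/
lemma unifProb_card_gt_le {ι : Type*} [Fintype ι] {n N M : ℕ} (hn : 0 < n) (hN : N ≤ n)
    (hι : Fintype.card ι = n) :
    unifProb {x : ι → Fin n | M < (Finset.univ.filter fun i => (x i).val < N).card} ≤
      Real.exp N / 2 ^ M := by
  classical
  set S : (ι → Fin n) → ℕ := fun x => (Finset.univ.filter fun i => (x i).val < N).card with hS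
  -- The exponential moment of the count with base 2, for Markov's inequality; its mean `(1 + N / n)
  -- ^ n` is at most `exp N`.
  have hsum : ∑ x : ι → Fin n, (2 : ℝ) ^ S x = ((n : ℝ) + N) ^ n := by
    have h1 : ∀ x : ι → Fin n, (2 : ℝ) ^ S x = ∏ i, if (x i).val < N then (2 : ℝ) else 1 := by
      intro x
      rw [Finset.prod_ite, Finset.prod_const, Finset.prod_const_one, mul_one]
    have h2 : ∑ y : Fin n, (if y.val < N then (2 : ℝ) else 1) = n + N := by
      have h3 : ∀ y : Fin n, (if y.val < N then (2 : ℝ) else 1) =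
          1 + if y.val < N then 1 else 0 := by
        intro y
        split_ifs <;> norm_num
      simp only [h3, Finset.sum_add_distrib, Finset.sum_boole]
      rw [Fin.card_filter_val_lt, min_eq_right hN]
      simp
    simp only [h1]
    rw [← Fintype.piFinset_univ, Finset.sum_prod_piFinset Finset.univ
      (fun _ (y : Fin n) => if y.val < N then (2 : ℝ) else 1)]
    simp only [h2, Finset.prod_const, Finset.card_univ, hι]
  have hcount : ({x : ι → Fin n | M < S x}.ncard : ℝ) * 2 ^ M ≤ ((n : ℝ) + N) ^ n := by
    rw [← hsum, Set.ncard_eq_toFinset_card', ← nsmul_eq_mul, ← Finset.sum_const]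
    refine (Finset.sum_le_sum fun x hx => ?_).trans
      (Finset.sum_le_sum_of_subset_of_nonneg (Finset.subset_univ _) fun x _ _ => by positivity)
    simp only [Set.mem_toFinset, Set.mem_ofPred_eq] at hx
    exact pow_le_pow_right₀ one_le_two hx.le
  have hn' : (0 : ℝ) < n := by exact_mod_cast hn
  have hexp : ((n : ℝ) + N) ^ n ≤ Real.exp N * n ^ n := by
    have h1 : (n : ℝ) + N ≤ Real.exp (N / n) * n := by
      have := Real.add_one_le_exp ((N : ℝ) / n)
      calc (n : ℝ) + N = ((N : ℝ) / n + 1) * n := by field_simp; ring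
        _ ≤ _ := by gcongr
    calc ((n : ℝ) + N) ^ n ≤ (Real.exp (N / n) * n) ^ n := by gcongr
      _ = Real.exp N * n ^ n := by
        rw [mul_pow, ← Real.exp_nat_mul]
        congr 2
        field_simp
  rw [unifProb, Nat.card_eq_fintype_card, Fintype.card_fun, Fintype.card_fin, hι,
    div_le_div_iff₀ (by positivity) (by positivity)]
  push_cast
  exact hcount.trans hexp

end UnifProb

section Seeds

variable {V A B C : Type} [Fintype V] [Finite A] [Finite B] [Finite C]

lemma unifProb_fst_le [Nonempty A] {E : Set (V → A × B × C)} {F : Set (V → A)} {q : ℝ}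
    (hq : 0 ≤ q) (hF : unifProb F ≤ q) (h : ∀ s ∈ E, (fun v => (s v).1) ∈ F) : unifProb E ≤ q := by
  let e : (V → A × B × C) ≃ (V → B × C) × (V → A) :=
    { toFun := fun s => (fun v => (s v).2, fun v => (s v).1)
      invFun := fun y v => (y.2 v, y.1 v)
      left_inv := fun _ => rfl
      right_inv := fun _ => rfl }
  refine unifProb_le_of_fiber e hq fun a => (unifProb_mono fun b hb => ?_).trans hF
  exact h _ hb

lemma unifProb_snd_le [Nonempty B] {E : Set (V → A × B × C)} {q : ℝ} (hq : 0 ≤ q)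
    (h : ∀ (x : V → A) (z : V → C), unifProb {y : V → B | (fun v => (x v, y v, z v)) ∈ E} ≤ q) :
    unifProb E ≤ q := by
  let e : (V → A × B × C) ≃ ((V → A) × (V → C)) × (V → B) :=
    { toFun := fun s => ((fun v => (s v).1, fun v => (s v).2.2), fun v => (s v).2.1)
      invFun := fun y v => (y.1.1 v, y.2 v, y.1.2 v)
      left_inv := fun _ => rfl
      right_inv := fun _ => rfl }
  exact unifProb_le_of_fiber e hq fun a => h a.1 a.2

lemma unifProb_thd_le [DecidableEq V] [Nonempty C] {E : Set (V → A × B × C)} {q : ℝ} (hq : 0 ≤ q) (r : V)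
    (h : ∀ (x : V → A) (y : V → B) (z : V → C),
      unifProb {c : C | (fun v => (x v, y v, if v = r then c else z v)) ∈ E} ≤ q) :
    unifProb E ≤ q := by
  let e : (V → A × B × C) ≃ ((V → A × B) × ({v // v ≠ r} → C)) × C :=
    { toFun := fun s => ((fun v => ((s v).1, (s v).2.1), fun v => (s v).2.2), (s r).2.2)
      invFun := fun y v => ((y.1.1 v).1, (y.1.1 v).2, if h : v = r then y.2 else y.1.2 ⟨v, h⟩)
      left_inv := fun s => by
        funext v
        by_cases hv : v = r
        · subst hv; simp
        · simp [hv]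
      right_inv := fun y => by
        obtain ⟨⟨y1, y2⟩, y3⟩ := y
        refine Prod.ext (Prod.ext rfl (funext fun v => ?_)) ?_
        · simp [v.2]
        · simp }
  refine unifProb_le_of_fiber e hq fun a => ?_
  have c0 : C := Classical.arbitrary C
  refine (h (fun v => (a.1 v).1) (fun v => (a.1 v).2)
    (fun v => if h : v = r then c0 else a.2 ⟨v, h⟩)).trans' (le_of_eq ?_)
  congr 1
  ext c
  have : e.symm (a, c) = fun v => ((a.1 v).1, (a.1 v).2, if v = r then c else
      if h : v = r then c0 else a.2 ⟨v, h⟩) := by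
    funext v
    by_cases hv : v = r <;> simp [e, hv]
  rw [Set.mem_ofPred_eq, Set.mem_ofPred_eq, this]

/-- Deferred decision: once all other coordinates are revealed, at most one value at `u` is bad. -/
lemma unifProb_le_of_update [DecidableEq V] [Nonempty B] (u : V) {E : Set (V → B)}
    (h : ∀ y ∈ E, ∀ y' ∈ E, (∀ v, v ≠ u → y v = y' v) → y u = y' u) :
    unifProb E ≤ (Nat.card B : ℝ)⁻¹ := by
  let e : (V → B) ≃ ({v // v ≠ u} → B) × B := (Equiv.funSplitAt u B).trans (Equiv.prodComm _ _)
  refine unifProb_le_of_fiber e (by positivity) fun a => unifProb_le_inv_card ?_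
  intro b hb b' hb'
  have h1 := h _ hb _ hb' (fun v hv => by simp [e, Equiv.funSplitAt, Equiv.piSplitAt, hv])
  simpa [e, Equiv.funSplitAt, Equiv.piSplitAt] using h1

end Seeds

/-! ### Label collisions and fingerprint collisions. -/

namespace TesterParams

variable {n : ℕ} {P : TesterParams n}

/-- The weights that the nodes choose when about `N` nodes are sampled. -/
def weights (N : ℕ) (seed : Fin n → P.Seed) (v : Fin n) : ℕ := seedWeight N (seed v)

open Classical in
/-- Two vertices are unlikely to get the same label if the first has many neighbours that the second
has not. -/
lemma unifProb_labelOf_eq_le (hn : 0 < n) (G : SimpleGraph (Fin n)) (v v' : Fin n) {N : ℕ}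
    (hN : N ≤ n) :
    unifProb {seed : Fin n → P.Seed | labelOf G (weights N seed) v = labelOf G (weights N seed) v'}
      ≤ ((n - N) / n : ℝ) ^ (Finset.univ.filter fun u => G.Adj v u ∧ ¬ G.Adj v' u).card +
        (P.weightBound : ℝ)⁻¹ := by
  have : Nonempty (Fin n) := ⟨⟨0, hn⟩⟩
  have : Nonempty (Fin P.weightBound) := ⟨⟨0, P.weightBound_pos⟩⟩
  set D := Finset.univ.filter fun u => G.Adj v u ∧ ¬ G.Adj v' u with hD
  -- Either no vertex of `D` is sampled, or one is and the labels still agree. In the second case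
  -- its weight counts for `v` but not for `v'`, so with all else fixed at most one weight gives a
  -- tie.
  have hsub : {seed : Fin n → P.Seed |
      labelOf G (weights N seed) v = labelOf G (weights N seed) v'} ⊆
      {seed | ∀ u ∈ D, N ≤ (seed u).1.val} ∪
      {seed | (∃ u ∈ D, (seed u).1.val < N) ∧
        labelOf G (weights N seed) v = labelOf G (weights N seed) v'} := by
    intro seed hs
    by_cases h : ∀ u ∈ D, N ≤ (seed u).1.val
    · exact Or.inl h
    · push Not at h
      exact Or.inr ⟨h, hs⟩
  refine (unifProb_mono hsub).trans ((unifProb_union_le _ _).trans (add_le_add ?_ ?_))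
  · have h1 := unifProb_pi_subset D (Finset.univ.filter fun y : Fin n => N ≤ y.val)
    have hcard : (Finset.univ.filter fun y : Fin n => N ≤ y.val).card = n - N := by
      have h2 := Finset.card_filter_add_card_filter_not (s := (Finset.univ : Finset (Fin n)))
        (fun y : Fin n => y.val < N)
      rw [Fin.card_filter_val_lt, min_eq_right hN, Finset.card_univ, Fintype.card_fin] at h2
      simp only [not_lt] at h2
      omega
    rw [hcard, Fintype.card_fin, Nat.cast_sub hN] at h1
    refine unifProb_fst_le (pow_nonneg (div_nonneg ?_ (Nat.cast_nonneg n)) _) h1.le ?_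
    · rw [sub_nonneg]
      exact_mod_cast hN
    · intro s hs u hu
      simpa using hs u hu
  · refine unifProb_snd_le (by positivity) fun x z => ?_
    by_cases hx : ∃ u ∈ D, (x u).val < N
    · obtain ⟨u, hu, hux⟩ := hx
      have hcard := unifProb_le_of_update (B := Fin P.weightBound) (V := Fin n) u
        (E := {y : Fin n → Fin P.weightBound | (fun v => (x v, y v, z v)) ∈ {seed : Fin n → P.Seed |
          (∃ u ∈ D, (seed u).1.val < N) ∧
          labelOf G (weights N seed) v = labelOf G (weights N seed) v'}}) ?_
      · simpa using hcard
      · rintro y ⟨-, hy⟩ y' ⟨-, hy'⟩ hyy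
        simp only [hD, Finset.mem_filter, Finset.mem_univ, true_and] at hu
        have hw : ∀ t, t ≠ u → weights N (fun v => ((x v, y v, z v) : P.Seed)) t =
            weights N (fun v => ((x v, y' v, z v) : P.Seed)) t := by
          intro t ht
          simp only [weights, seedWeight, hyy t ht]
        have h1 : labelOf G (weights N (fun v => ((x v, y v, z v) : P.Seed))) v' =
            labelOf G (weights N (fun v => ((x v, y' v, z v) : P.Seed))) v' := by
          rw [labelOf, labelOf]
          refine Finset.sum_congr rfl fun t ht => hw t ?_
          rintro rfl
          simp only [Finset.mem_filter, Finset.mem_univ, true_and] at ht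
          exact hu.2 ht.symm
        have h2 : labelOf G (weights N (fun v => ((x v, y v, z v) : P.Seed))) v =
            labelOf G (weights N (fun v => ((x v, y' v, z v) : P.Seed))) v := by
          rw [hy, hy', h1]
        have hmem : u ∈ Finset.univ.filter fun t => G.Adj t v := by
          simp [hu.1.symm]
        rw [labelOf, labelOf, ← Finset.add_sum_erase _ _ hmem, ← Finset.add_sum_erase _ _ hmem,
          Finset.sum_congr rfl fun t ht => hw t (Finset.ne_of_mem_erase ht),
          add_left_inj] at h2
        simp only [weights, seedWeight, hux, if_true] at h2
        exact Fin.ext h2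
    · have : {y : Fin n → Fin P.weightBound | (fun v => (x v, y v, z v)) ∈ {seed : Fin n → P.Seed |
          (∃ u ∈ D, (seed u).1.val < N) ∧
          labelOf G (weights N seed) v = labelOf G (weights N seed) v'}} = ∅ := by
        ext y
        simp only [Set.mem_ofPred_eq, Set.mem_empty_iff_false, iff_false]
        rintro ⟨h, -⟩
        exact hx h
      rw [this]
      simp [unifProb]

open Polynomial in
/-- Two weighted graphs with different fingerprint polynomials are unlikely to have the same
fingerprints at many random points. -/
lemma unifProb_fingerprint_eq_le (G H : SimpleGraph (Fin n)) (root : Fin n) {N k Q : ℕ}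
    (hk : k ≤ P.coins) {w' : Fin n → ℕ} (hQ' : ∀ v, labelOf H w' v < Q)
    (hQ : n * (P.weightBound - 1) < Q) :
    unifProb {seed : Fin n → P.Seed |
      fingerprint Q G (weights N seed) (X : (ZMod P.p)[X]) ≠ fingerprint Q H w' X ∧
      ∀ j < k, fingerprint Q G (weights N seed) (seedCoin (seed root) j) =
        fingerprint Q H w' (seedCoin (seed root) j)} ≤ ((2 * Q ^ 2 : ℕ) / P.p : ℝ) ^ k := by
  classical
  refine unifProb_thd_le (by positivity) root fun x y z => ?_
  set w : Fin n → ℕ := fun v => if (x v).val < N then (y v).val else 0 with hw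
  -- The weights ignore the coins, so both polynomials are fixed before the leader draws its points.
  have hwe : ∀ c, weights N (fun v => ((x v, y v, if v = root then c else z v) : P.Seed)) = w := by
    intro c
    funext v
    simp [weights, seedWeight, hw]
  by_cases hne : fingerprint Q G w (X : (ZMod P.p)[X]) = fingerprint Q H w' X
  · have : {c : Fin P.coins → ZMod P.p | (fun v => (x v, y v, if v = root then c else z v)) ∈ {seed : Fin n → P.Seed |
        fingerprint Q G (weights N seed) (X : (ZMod P.p)[X]) ≠ fingerprint Q H w' X ∧
        ∀ j < k, fingerprint Q G (weights N seed) (seedCoin (seed root) j) =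
          fingerprint Q H w' (seedCoin (seed root) j)}} = ∅ := by
      ext c
      simp only [Set.mem_ofPred_eq, Set.mem_empty_iff_false, iff_false, hwe]
      exact fun h => h.1 hne
    rw [this]
    simp only [unifProb, Set.ncard_empty, Nat.cast_zero, zero_div]
    positivity
  · set Z := Finset.univ.filter fun c : ZMod P.p => fingerprint Q G w c = fingerprint Q H w' c
      with hZ
    have hwlt : ∀ v, labelOf G w v < Q := by
      intro v
      refine (labelOf_le G (W := P.weightBound - 1) (fun u => ?_) v).trans_lt
        (by rwa [Fintype.card_fin])
      simp only [hw]
      split_ifs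
      · have := (y u).2
        omega
      · exact Nat.zero_le _
    have hZcard := card_fingerprint_eq_le hwlt hQ' hne
    have hD : (Finset.univ.filter fun j : Fin P.coins => j.val < k).card = k := by
      rw [Fin.card_filter_val_lt, min_eq_right hk]
    have h1 := unifProb_pi_subset (Finset.univ.filter fun j : Fin P.coins => j.val < k) Z
    rw [hD, ZMod.card] at h1
    refine (unifProb_mono ?_).trans (h1.le.trans ?_)
    · intro c hc j hj
      simp only [Set.mem_ofPred_eq, hwe] at hc
      simp only [Finset.mem_filter, Finset.mem_univ, true_and] at hj
      have := hc.2 j hj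
      simpa [seedCoin, hZ] using this
    · gcongr

end TesterParams

/-! ### The decision of the leader and its error. -/

open Classical in
/-- The weight function given by a list of weighted vertices. -/
noncomputable def candidate {V : Type*} {M W : ℕ} (q : Fin M → V × Fin W) (v : V) : ℕ :=
  (Finset.univ.filter fun i => (q i).1 = v).sup fun i => (q i).2.val

lemma candidate_le {V : Type*} {M W : ℕ} (q : Fin M → V × Fin W) (v : V) :
    candidate q v ≤ W - 1 := by
  classical
  refine Finset.sup_le fun i _ => ?_
  have := (q i).2.2
  omega

/-- Lists of length `M` reach every weight function with at most `M` nonzero weights and are easy to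
count. Unused places repeat an arbitrary vertex with its true weight, which the supremum in
`candidate` ignores. -/
lemma exists_candidate_eq {V : Type*} [Fintype V] [Nonempty V] {M W : ℕ} {w : V → ℕ}
    (hw : ∀ v, w v < W) {S : Finset V} (hS : ∀ v, v ∉ S → w v = 0) (hM : S.card ≤ M) :
    ∃ q : Fin M → V × Fin W, candidate q = w := by
  classical
  set f : Fin M → V := fun i =>
    if h : i.val < S.card then (S.equivFin.symm ⟨i, h⟩ : V) else Classical.arbitrary V with hf
  refine ⟨fun i => (f i, ⟨w (f i), hw _⟩), ?_⟩
  funext v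
  rw [candidate]
  by_cases hv : v ∈ S
  · refine le_antisymm (Finset.sup_le fun i hi => ?_) ?_
    · simp only [Finset.mem_filter, Finset.mem_univ, true_and] at hi
      simp [hi]
    · set i := S.equivFin ⟨v, hv⟩ with hi
      have hfi : f ⟨i.val, i.2.trans_le hM⟩ = v := by
        simp [hf, hi]
      have := Finset.le_sup (f := fun i => w (f i))
        (s := Finset.univ.filter fun i => f i = v) (b := ⟨i.val, i.2.trans_le hM⟩) (by simp [hfi])
      simpa only [hfi] using this
  · rw [hS v hv]
    refine Nat.le_zero.1 (Finset.sup_le fun i hi => ?_)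
    simp only [Finset.mem_filter, Finset.mem_univ, true_and] at hi
    simp [hi, hS v hv]

open Classical in
/-- The decision rule of the leader: it looks for a sparse weight function on the known graph with
the observed fingerprints. -/
noncomputable def fingerprintVerdict {n p : ℕ} (M W k : ℕ) (H : SimpleGraph (Fin n))
    (r F : ℕ → ZMod p) : Verdict :=
  if ∃ q : Fin M → Fin n × Fin W, ∀ j < k, F j = fingerprint (n * W) H (candidate q) (r j)
  then .accept else .reject

namespace TesterParams

section Analysis

variable {n : ℕ} {P : TesterParams n} {G H : SimpleGraph (Fin n)}

/-- The weights transported along `φ` have the same fingerprints at every point, so the coins cause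
no error on this side. -/
lemma fingerprintVerdict_eq_accept (hn : 0 < n) (φ : G ≃g H) {N M k : ℕ} {seed : Fin n → P.Seed}
    (hM : (Finset.univ.filter fun v => (seed v).1.val < N).card ≤ M) {r F : ℕ → ZMod P.p}
    (hF : ∀ j < k, F j = fingerprint (n * P.weightBound) G (weights N seed) (r j)) :
    fingerprintVerdict M P.weightBound k H r F = .accept := by
  have : Nonempty (Fin n) := ⟨⟨0, hn⟩⟩
  obtain ⟨q, hq⟩ := exists_candidate_eq (W := P.weightBound) (M := M)
    (w := fun x => weights N seed (φ.symm x)) (fun v => seedWeight_lt _ _)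
    (S := (Finset.univ.filter fun v => (seed v).1.val < N).map φ.toEquiv.toEmbedding)
    (fun v hv => by
      simp only [Finset.mem_map, Finset.mem_filter, Finset.mem_univ, true_and, not_exists,
        not_and] at hv
      have h1 : ¬ (seed (φ.symm v)).1.val < N := fun h => hv (φ.symm v) h (by simp)
      simp [weights, seedWeight, h1]) (by rwa [Finset.card_map])
  rw [fingerprintVerdict, if_pos]
  exact ⟨q, fun j hj => by rw [hF j hj, hq, fingerprint_iso φ]⟩

open Classical in
/-- If the network is far from the known graph, the leader is unlikely to accept. -/
lemma unifProb_accept_le (hn : 0 < n) (root : Fin n) {N M k : ℕ} (hN : N ≤ n) (hk : k ≤ P.coins)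
    (hp : n ^ 2 < P.p) {K η : ℝ}
    (hη : ∀ m : ℕ, K < m → ((n - N) / n : ℝ) ^ m ≤ η)
    (hfar : ∀ G' : SimpleGraph (Fin n), Nonempty (G' ≃g H) →
      8 * (K * n) < ((symmDiff G.edgeSet G'.edgeSet).ncard : ℝ)) :
    unifProb {seed : Fin n → P.Seed | ∃ q : Fin M → Fin n × Fin P.weightBound, ∀ j < k,
      fingerprint (n * P.weightBound) G (weights N seed) (seedCoin (seed root) j) =
        fingerprint (n * P.weightBound) H (candidate q) (seedCoin (seed root) j)} ≤
      (n : ℝ) ^ 2 * (η + (P.weightBound : ℝ)⁻¹) +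
        ((n * P.weightBound : ℕ) : ℝ) ^ M *
          ((2 * (n * P.weightBound) ^ 2 : ℕ) / P.p : ℝ) ^ k := by
  set Q := n * P.weightBound with hQdef
  have hQ : n * (P.weightBound - 1) < Q :=
    Nat.mul_lt_mul_of_pos_left (Nat.sub_lt P.weightBound_pos one_pos) hn
  have hη0 : 0 ≤ η := by
    obtain ⟨m, hm⟩ := exists_nat_gt K
    refine le_trans (pow_nonneg (div_nonneg ?_ (Nat.cast_nonneg n)) m) (hη m hm)
    rw [sub_nonneg]
    exact_mod_cast hN
  set bad : Fin n × Fin n → Set (Fin n → P.Seed) := fun vv => {seed |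
    K < (Finset.univ.filter fun u => G.Adj vv.1 u ∧ ¬ G.Adj vv.2 u).card ∧
    labelOf G (weights N seed) vv.1 = labelOf G (weights N seed) vv.2} with hbad
  have hbadle : ∀ vv, unifProb (bad vv) ≤ η + (P.weightBound : ℝ)⁻¹ := by
    intro vv
    by_cases hK : K < (Finset.univ.filter fun u => G.Adj vv.1 u ∧ ¬ G.Adj vv.2 u).card
    · refine (unifProb_mono fun seed hs => hs.2).trans
        ((unifProb_labelOf_eq_le hn G vv.1 vv.2 hN).trans ?_)
      gcongr
      exact hη _ hK
    · have : bad vv = ∅ := by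
        ext seed
        simp [hbad, hK]
      rw [this]
      simp only [unifProb, Set.ncard_empty, Nat.cast_zero, zero_div]
      positivity
  set coll : (Fin M → Fin n × Fin P.weightBound) → Set (Fin n → P.Seed) := fun q => {seed |
    fingerprint Q G (weights N seed) (Polynomial.X : Polynomial (ZMod P.p)) ≠
      fingerprint Q H (candidate q) Polynomial.X ∧
    ∀ j < k, fingerprint Q G (weights N seed) (seedCoin (seed root) j) =
      fingerprint Q H (candidate q) (seedCoin (seed root) j)} with hcoll
  have hcandQ : ∀ (q : Fin M → Fin n × Fin P.weightBound) v, labelOf H (candidate q) v < Q := by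
    intro q v
    refine (labelOf_le H (candidate_le q) v).trans_lt ?_
    rwa [Fintype.card_fin]
  have hcollle : ∀ q, unifProb (coll q) ≤ ((2 * Q ^ 2 : ℕ) / P.p : ℝ) ^ k := fun q =>
    unifProb_fingerprint_eq_le G H root hk (hcandQ q) hQ
  -- Outside the label collisions `bad` and the polynomial collisions `coll`, an accepted candidate
  -- has the same fingerprint polynomial as the network, and `exists_iso_close` contradicts `hfar`.
  have hsub : {seed : Fin n → P.Seed | ∃ q : Fin M → Fin n × Fin P.weightBound, ∀ j < k,
      fingerprint Q G (weights N seed) (seedCoin (seed root) j) =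
        fingerprint Q H (candidate q) (seedCoin (seed root) j)} ⊆
      {seed | ∃ vv, seed ∈ bad vv} ∪ {seed | ∃ q, seed ∈ coll q} := by
    rintro seed ⟨q, hq⟩
    by_cases hb : ∃ vv, seed ∈ bad vv
    · exact Or.inl hb
    · refine Or.inr ⟨q, ?_, hq⟩
      intro heq
      have hwQ : ∀ v, labelOf G (weights N seed) v < Q := by
        intro v
        refine (labelOf_le G (W := P.weightBound - 1) (fun u => ?_) v).trans_lt
          (by rwa [Fintype.card_fin])
        have := seedWeight_lt N (seed u)
        rw [weights]
        omega
      obtain ⟨h1, h2⟩ := card_eq_of_fingerprint_eq hwQ (hcandQ q) (by rwa [Fintype.card_fin])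
        (by rwa [Fintype.card_fin]) heq
      obtain ⟨G', hG', hle⟩ := exists_iso_close (K := K) (fun u u' huu => by
        by_contra hlt
        exact hb ⟨(u, u'), not_le.1 hlt, huu⟩) h1 h2
      rw [Fintype.card_fin] at hle
      exact absurd hle (not_le.2 (hfar G' hG'))
  refine (unifProb_mono hsub).trans ((unifProb_union_le _ _).trans (add_le_add ?_ ?_))
  · refine (unifProb_exists_le hbadle).trans_eq ?_
    simp [pow_two]
  · refine (unifProb_exists_le hcollle).trans_eq ?_
    simp [hQdef]

end Analysis

end TesterParams

/-! ### Numerical estimates. -/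

section Estimates

variable {n N c : ℕ} {s : ℝ}

lemma exp_neg_mul_log (hn : 0 < n) (k : ℕ) : Real.exp (-(k * Real.log n)) = ((n : ℝ) ^ k)⁻¹ := by
  have hn' : (0 : ℝ) < n := by exact_mod_cast hn
  rw [Real.exp_neg, ← Real.log_pow, Real.exp_log (by positivity)]

/-- By `1 - x ≤ exp (-x)` the power is at most `exp (-(N * s))`. If the sample size was cut off at
`n`, every node is sampled and the base is 0. -/
lemma miss_probability_le (hn : 0 < n) (hN : N ≤ n) (hs : 0 < s)
    (h : N = n ∨ (c : ℝ) * Real.log n ≤ N * s) (m : ℕ) (hm : s * n < m) :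
    ((n - N) / n : ℝ) ^ m ≤ ((n : ℝ) ^ c)⁻¹ := by
  have hn' : (0 : ℝ) < n := by exact_mod_cast hn
  have hN' : (N : ℝ) ≤ n := by exact_mod_cast hN
  rcases h with rfl | h
  · have hm0 : m ≠ 0 := by
      rintro rfl
      have : 0 < s * N := by positivity
      push_cast at hm
      linarith
    rw [sub_self, zero_div, zero_pow hm0]
    positivity
  · have h1 : ((n - N) / n : ℝ) ≤ Real.exp (-(N / n)) := by
      have := Real.add_one_le_exp (-((N : ℝ) / n))
      rw [sub_div, div_self hn'.ne']
      linarith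
    calc ((n - N) / n : ℝ) ^ m ≤ Real.exp (-(N / n)) ^ m := by
          gcongr
      _ = Real.exp (-(m * (N / n))) := by
          rw [← Real.exp_nat_mul]
          ring_nf
      _ ≤ Real.exp (-(c * Real.log n)) := by
          refine Real.exp_le_exp.2 (neg_le_neg (h.trans ?_))
          calc (N : ℝ) * s = s * n * (N / n) := by field_simp
            _ ≤ m * (N / n) := by gcongr
      _ = _ := exp_neg_mul_log hn c

/-- The tail bound is `exp N / 2 ^ (4 * N)`, which is at most `exp (-N)` because `exp 1 ^ 2 ≤ 16`.
-/
lemma unifProb_sample_large_le {P : TesterParams n} (hn : 0 < n) (hN : N ≤ n)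
    (h : N = n ∨ (c : ℝ) * Real.log n ≤ N) :
    unifProb {seed : Fin n → P.Seed |
      4 * N < (Finset.univ.filter fun v => (seed v).1.val < N).card} ≤ ((n : ℝ) ^ c)⁻¹ := by
  have : Nonempty (Fin n) := ⟨⟨0, hn⟩⟩
  rcases h with rfl | h
  · have : {seed : Fin N → P.Seed |
        4 * N < (Finset.univ.filter fun v => (seed v).1.val < N).card} = ∅ := by
      ext seed
      simp only [Fin.is_lt, Finset.filter_true, Finset.card_univ, Fintype.card_fin,
        Set.mem_ofPred_eq, Set.mem_empty_iff_false, iff_false]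
      omega
    rw [this]
    simp only [unifProb, Set.ncard_empty, Nat.cast_zero, zero_div]
    positivity
  · refine unifProb_fst_le (by positivity) ((unifProb_card_gt_le (ι := Fin n) (M := 4 * N) hn hN
      (Fintype.card_fin n)).trans ?_) (fun seed hs => hs)
    rw [← exp_neg_mul_log hn c]
    calc Real.exp N / 2 ^ (4 * N) ≤ Real.exp (-N) := by
          rw [div_le_iff₀ (by positivity), Real.exp_neg, ← div_eq_inv_mul,
            le_div_iff₀ (Real.exp_pos _), pow_mul]
          have he : Real.exp 1 * Real.exp 1 ≤ 2 ^ 4 := by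
            have := Real.exp_one_lt_d9
            have := Real.exp_pos 1
            nlinarith
          calc Real.exp N * Real.exp N = (Real.exp 1 * Real.exp 1) ^ N := by
                rw [mul_pow, ← Real.exp_nat_mul, mul_one]
            _ ≤ _ := by gcongr
      _ ≤ _ := by gcongr

/-- The prime is large enough that each point gains a factor `1 / n`. Of the points, `(c + 5) * M`
pay for the `(n ^ (c + 5)) ^ M` candidates and `c + 1` remain. The pairs of vertices also cost at
most `1 / n ^ (c + 1)`, and `2 ≤ n` absorbs the sum of the two. -/
lemma error_sum_le (hn : 2 ≤ n) {p M : ℕ} (hp : n ^ (2 * c + 12) < p) :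
    (n : ℝ) ^ 2 * (((n : ℝ) ^ (c + 4))⁻¹ + ((n ^ (c + 4) : ℕ) : ℝ)⁻¹) +
      ((n * n ^ (c + 4) : ℕ) : ℝ) ^ M * ((2 * (n * n ^ (c + 4)) ^ 2 : ℕ) / p : ℝ) ^
        ((c + 5) * M + c + 1) ≤ ((n : ℝ) ^ c)⁻¹ := by
  have hn' : (2 : ℝ) ≤ n := by exact_mod_cast hn
  have hn0 : (0 : ℝ) < n := by linarith
  have hratio : ((2 * (n * n ^ (c + 4)) ^ 2 : ℕ) / p : ℝ) ≤ (n : ℝ)⁻¹ := by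
    have hp' : ((n : ℝ)) ^ (2 * c + 12) ≤ p := by exact_mod_cast hp.le
    have hp0 : (0 : ℝ) < p := lt_of_lt_of_le (by positivity) hp'
    rw [div_le_iff₀ hp0, ← div_eq_inv_mul, le_div_iff₀ hn0]
    refine le_trans ?_ hp'
    push_cast
    calc (2 : ℝ) * ((n : ℝ) * (n : ℝ) ^ (c + 4)) ^ 2 * n
        ≤ n * ((n : ℝ) * (n : ℝ) ^ (c + 4)) ^ 2 * n := by gcongr
      _ = (n : ℝ) ^ (2 * c + 12) := by ring
  have h1 : ((n * n ^ (c + 4) : ℕ) : ℝ) ^ M * ((2 * (n * n ^ (c + 4)) ^ 2 : ℕ) / p : ℝ) ^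
        ((c + 5) * M + c + 1) ≤ ((n : ℝ) ^ (c + 1))⁻¹ := by
    calc ((n * n ^ (c + 4) : ℕ) : ℝ) ^ M * ((2 * (n * n ^ (c + 4)) ^ 2 : ℕ) / p : ℝ) ^
        ((c + 5) * M + c + 1)
        ≤ ((n * n ^ (c + 4) : ℕ) : ℝ) ^ M * ((n : ℝ)⁻¹) ^ ((c + 5) * M + c + 1) := by gcongr
      _ = ((n : ℝ) ^ (c + 1))⁻¹ := by
          push_cast
          rw [show (n : ℝ) * n ^ (c + 4) = n ^ (c + 5) by ring, ← pow_mul, inv_pow, add_assoc,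
            pow_add (n : ℝ) ((c + 5) * M), mul_inv, ← mul_assoc, mul_inv_cancel₀ (by positivity),
            one_mul]
  have h2 : (n : ℝ) ^ 2 * (((n : ℝ) ^ (c + 4))⁻¹ + ((n ^ (c + 4) : ℕ) : ℝ)⁻¹) ≤
      ((n : ℝ) ^ (c + 1))⁻¹ := by
    push_cast
    rw [← two_mul, le_inv_comm₀ (by positivity) (by positivity)]
    have : ((n : ℝ) ^ 2 * (2 * ((n : ℝ) ^ (c + 4))⁻¹))⁻¹ = (n : ℝ) ^ (c + 1) * n / 2 := by
      field_simp
      ring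
    rw [this, le_div_iff₀ two_pos]
    gcongr
  have h3 : 2 * ((n : ℝ) ^ (c + 1))⁻¹ ≤ ((n : ℝ) ^ c)⁻¹ := by
    rw [pow_succ, mul_inv, mul_comm, mul_assoc]
    refine mul_le_of_le_one_right (by positivity) ?_
    rw [← div_eq_inv_mul, div_le_one hn0]
    exact hn'
  linarith

end Estimates

/-! ### Choice of parameters and the main theorem. -/

/-- The sample size of the tester. -/
noncomputable def sampleSize (c : ℕ) (δ : ℝ) (n : ℕ) (ε : ℝ) : ℕ :=
  -- The summand 1 is for the tail bound on the number of samples, `16 / (δ * ε)` for hitting every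
  -- large difference of neighbourhoods.
  min n ⌈((c : ℝ) + 4) * Real.log n * (1 + 16 / (δ * ε))⌉₊

/-- The number of fingerprints for a given sample size. -/
def repetitions (c N : ℕ) : ℕ := (c + 5) * (4 * N) + c + 1

/-- The parameters with which the tester is used. -/
noncomputable def isoTesterParams (a c : ℕ) (δ : ℝ) {n : ℕ} (hn : 2 ≤ n) : TesterParams n where
  idBound := n ^ a
  weightBound := n ^ (c + 4)
  weightBound_pos := by positivity
  p := (Nat.exists_prime_lt_and_le_two_mul (n ^ (2 * c + 12)) (by positivity)).choose
  prime := (Nat.exists_prime_lt_and_le_two_mul (n ^ (2 * c + 12)) (by positivity)).choose_spec.1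
  coins := repetitions c n
  samples := sampleSize c δ n
  reps := repetitions c
  decide H ε r F :=
    fingerprintVerdict (4 * sampleSize c δ n ε) (n ^ (c + 4)) (repetitions c (sampleSize c δ n ε))
      H r F

/-- The algorithm in which every node accepts at once. -/
def acceptingAlgorithm (n B : ℕ) : CongestAlgorithm n B where
  Seed := Unit
  seed_finite := inferInstance
  seed_nonempty := inferInstance
  State := Unit
  init _ _ _ := ()
  send _ _ := none
  receive _ _ := ()
  output _ := some .accept

/-- The isomorphism tester. -/
noncomputable def isoTester (a c : ℕ) (δ : ℝ) (n : ℕ) :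
    CongestAlgorithm n (a + 2 * c + 16) :=
  if hn : 2 ≤ n then (isoTesterParams a c δ hn).algorithm (by omega) _
  else acceptingAlgorithm n _

/-- The factor in the running time of the tester. -/
noncomputable def timeFactor (c : ℕ) (δ : ℝ) : ℝ :=
  24 + (8 * ((c : ℝ) + 5) * (((c : ℝ) + 4) * (1 + 16 / δ) * 2 + 4) + 8 * ((c : ℝ) + 1) + 12)

/-- The cost is linear in `L = ε⁻¹ * log n`. As `L ≥ 1 / 2`, both `L ≤ 2 * L ^ 2` and `1 ≤ 4 * L ^
2` hold, which gives the square in the claim. -/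
lemma le_floor_time {c n D : ℕ} {δ ε : ℝ} (hn : 2 ≤ n) (hδ : 0 < δ) (hε : 0 < ε) (hε1 : ε < 1) :
    24 * D + 2 * repetitions c (sampleSize c δ n ε) + 3 ≤
      ⌊timeFactor c δ * ((D : ℝ) + (ε⁻¹ * Real.log n) ^ 2)⌋₊ := by
  refine Nat.le_floor ?_
  have hlog : (1 / 2 : ℝ) ≤ Real.log n := by
    have h1 : Real.log 2 ≤ Real.log n := Real.log_le_log two_pos (by exact_mod_cast hn)
    linarith [Real.log_two_gt_d9]
  have hε' : 1 ≤ ε⁻¹ := (one_le_inv₀ hε).2 hε1.le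
  set L := ε⁻¹ * Real.log n with hL
  have hlogL : Real.log n ≤ L := le_mul_of_one_le_left (by linarith) hε'
  have hL1 : 1 ≤ 4 * L ^ 2 := by nlinarith
  have hL2 : L ≤ 2 * L ^ 2 := by nlinarith
  have hN : (sampleSize c δ n ε : ℝ) ≤ (((c : ℝ) + 4) * (1 + 16 / δ) * 2 + 4) * L ^ 2 := by
    have h1 : (sampleSize c δ n ε : ℝ) ≤
        ⌈((c : ℝ) + 4) * Real.log n * (1 + 16 / (δ * ε))⌉₊ := by
      rw [sampleSize]
      exact Nat.cast_le.2 (min_le_right _ _)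
    have h2 := Nat.ceil_lt_add_one (a := ((c : ℝ) + 4) * Real.log n * (1 + 16 / (δ * ε)))
      (by positivity)
    have h3 : ((c : ℝ) + 4) * Real.log n * (1 + 16 / (δ * ε)) ≤
        ((c : ℝ) + 4) * (1 + 16 / δ) * L := by
      have h4 : Real.log n * (1 + 16 / (δ * ε)) = Real.log n + 16 / δ * L := by
        rw [hL]
        field_simp
      calc ((c : ℝ) + 4) * Real.log n * (1 + 16 / (δ * ε))
          = ((c : ℝ) + 4) * (Real.log n + 16 / δ * L) := by rw [← h4]; ring
        _ ≤ ((c : ℝ) + 4) * (L + 16 / δ * L) := by gcongr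
        _ = _ := by ring
    have h5 : ((c : ℝ) + 4) * (1 + 16 / δ) * L ≤ ((c : ℝ) + 4) * (1 + 16 / δ) * (2 * L ^ 2) := by
      gcongr
    linarith
  have hfac : 24 ≤ timeFactor c δ := by
    rw [timeFactor]
    have : 0 ≤ 8 * ((c : ℝ) + 5) * (((c : ℝ) + 4) * (1 + 16 / δ) * 2 + 4) + 8 * ((c : ℝ) + 1) + 12 := by
      positivity
    linarith
  have hD : 24 * (D : ℝ) ≤ timeFactor c δ * D := by gcongr
  have hrep : 2 * (repetitions c (sampleSize c δ n ε) : ℝ) + 3 ≤ timeFactor c δ * L ^ 2 := by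
    rw [repetitions]
    push_cast
    have h1 : 8 * ((c : ℝ) + 5) * (sampleSize c δ n ε : ℝ) ≤
        8 * ((c : ℝ) + 5) * ((((c : ℝ) + 4) * (1 + 16 / δ) * 2 + 4) * L ^ 2) := by gcongr
    have h2 : 2 * ((c : ℝ) + 1) * 1 ≤ 2 * ((c : ℝ) + 1) * (4 * L ^ 2) := by gcongr
    rw [timeFactor]
    nlinarith [sq_nonneg L]
  push_cast
  rw [mul_add]
  linarith

theorem theorem1 (a c : ℕ) (δ : ℝ) (hδ : 0 < δ) :
    ∃ (B : ℕ) (K : ℝ) (A : (n : ℕ) → CongestAlgorithm n B),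
      ∀ (n : ℕ) (GU : SimpleGraph (Fin n)) (ident : Fin n → ℕ),
        GU.Connected →
        δ * (n : ℝ) ^ 2 ≤ (GU.edgeSet.ncard : ℝ) →
        Function.Injective ident → (∀ v, ident v < n ^ a) →
        ∀ (GK : SimpleGraph (Fin n)) (ε : ℝ), 0 < ε → ε < 1 →
        ∀ R : Set (Fin n), R.Nonempty →
        ∀ T : ℕ, T = ⌊K * ((GU.diam : ℝ) + (ε⁻¹ * Real.log n) ^ 2)⌋₊ →
          (∀ (seed : Fin n → (A n).Seed) (v : Fin n),
            ((A n).verdict GU ident (testerInput R GK ε) seed T v).isSome) ∧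
          (Nonempty (GU ≃g GK) →
            1 - 1 / (n : ℝ) ^ c ≤
              (A n).prob {seed | ∀ v, (A n).verdict GU ident (testerInput R GK ε) seed T v =
                some Verdict.accept}) ∧
          (IsFarFromIso ε GU GK →
            1 - 1 / (n : ℝ) ^ c ≤
              (A n).prob {seed | ∃ v, (A n).verdict GU ident (testerInput R GK ε) seed T v =
                some Verdict.reject}) := by
  refine ⟨a + 2 * c + 16, timeFactor c δ, isoTester a c δ, ?_⟩
  intro n G ident hG hm hid hlt H ε hε hε1 R hR T hT
  -- A network with one node has no edges, against the density hypothesis; the trivial algorithm for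
  -- `n < 2` is never used.
  have hn : 2 ≤ n := by
    by_contra h
    have hsub : Subsingleton (Fin n) := ⟨fun u v => Fin.ext (by omega)⟩
    have hempty : G.edgeSet = ∅ := by
      rw [SimpleGraph.edgeSet_eq_empty]
      exact Subsingleton.elim _ _
    have hpos : (0 : ℝ) < n := by
      obtain ⟨v⟩ := hG.nonempty
      exact_mod_cast lt_of_le_of_lt (Nat.zero_le _) v.2
    rw [hempty, Set.ncard_empty, Nat.cast_zero] at hm
    have : 0 < δ * (n : ℝ) ^ 2 := by positivity
    linarith
  have hn0 : 0 < n := by omega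
  have hnR : (0 : ℝ) < n := by exact_mod_cast hn0
  have : Nontrivial (Fin n) := Fin.nontrivial_iff_two_le.2 hn
  have hdiam : 0 < G.diam := Nat.pos_of_ne_zero
    (SimpleGraph.diam_ne_zero_of_ediam_ne_top (SimpleGraph.connected_iff_ediam_ne_top.1 hG))
  rw [show isoTester a c δ n = (isoTesterParams a c δ hn).algorithm (by omega) _ from dif_pos hn]
  set P := isoTesterParams a c δ hn with hP
  set N := sampleSize c δ n ε with hNdef
  have hpspec := (Nat.exists_prime_lt_and_le_two_mul (n ^ (2 * c + 12))
    (by positivity)).choose_spec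
  have hp1 : n ^ (2 * c + 12) < P.p := hpspec.2.1
  have hp2 : P.p ≤ n ^ (2 * c + 13) := by
    refine hpspec.2.2.trans ?_
    rw [pow_succ, mul_comm]
    exact Nat.mul_le_mul_left _ hn
  have hNn : N ≤ n := min_le_left _ _
  have hNlarge : N = n ∨ ((c : ℝ) + 4) * Real.log n * (1 + 16 / (δ * ε)) ≤ N := by
    rcases min_choice n ⌈((c : ℝ) + 4) * Real.log n * (1 + 16 / (δ * ε))⌉₊ with h | h
    · exact Or.inl h
    · right
      rw [hNdef, sampleSize, h]
      exact Nat.le_ceil _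
  have hlog : 0 ≤ Real.log n := Real.log_natCast_nonneg n
  obtain ⟨root, hroot⟩ := TesterParams.exists_leader (P := P) (hn := hn0) (B := a + 2 * c + 16)
    (H := H) (ε := ε) (T := T) hG hid hlt
    (by
      change n ^ a * (n + 1) * n < _
      calc n ^ a * (n + 1) * n ≤ n ^ a * (n * n) * n := by
            gcongr
            nlinarith
        _ = n ^ (a + 3) := by ring
        _ < _ := Nat.pow_lt_pow_right hn (by omega))
    (by
      change n * n ^ (c + 4) < _
      rw [← pow_succ']
      exact Nat.pow_lt_pow_right hn (by omega))
    (by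
      calc n ^ a * P.p ≤ n ^ a * n ^ (2 * c + 13) := by gcongr
        _ = n ^ (a + 2 * c + 13) := by rw [← pow_add, add_assoc]
        _ ≤ _ := Nat.pow_le_pow_right hn0 (by omega))
    hNn hR hdiam (by
      rw [hT]
      exact le_floor_time hn hδ hε hε1)
  have hprob : ∀ E : Set (Fin n → P.Seed),
      (P.algorithm hn0 (a + 2 * c + 16)).prob E = unifProb E := fun E => rfl
  have hne : Nonempty P.Seed := (P.algorithm hn0 (a + 2 * c + 16)).seed_nonempty
  have hcompl : ∀ E : Set (Fin n → P.Seed), unifProb Eᶜ ≤ ((n : ℝ) ^ c)⁻¹ →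
      1 - 1 / (n : ℝ) ^ c ≤ (P.algorithm hn0 (a + 2 * c + 16)).prob E := by
    intro E hE
    rw [hprob, ← one_sub_unifProb_compl, one_div]
    linarith
  refine ⟨fun seed v => ?_, fun hiso => ?_, fun hfar => ?_⟩
  · obtain ⟨F, -, hv⟩ := hroot seed
    rw [hv v]
    rfl
  · obtain ⟨φ⟩ := hiso
    refine hcompl _ (le_trans (unifProb_mono ?_) (unifProb_sample_large_le (P := P) hn0 hNn ?_))
    · intro seed hs
      by_contra hsmall
      refine hs fun v => ?_
      obtain ⟨F, hF, hv⟩ := hroot seed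
      rw [hv v]
      congr 1
      split_ifs
      · exact TesterParams.fingerprintVerdict_eq_accept hn0 φ (N := N) (not_lt.1 hsmall) hF
      · rfl
    · refine hNlarge.imp_right fun h => le_trans ?_ h
      have h1 : 0 ≤ 16 / (δ * ε) := by positivity
      nlinarith [mul_nonneg (mul_nonneg (by positivity : (0 : ℝ) ≤ c + 4) hlog) h1]
  -- With this `K`, `8 * (K * n)` is half of `ε * δ * n ^ 2`, hence strictly below `ε * m`, as
  -- farness requires.
  · refine hcompl _ (le_trans (unifProb_mono ?_) ((TesterParams.unifProb_accept_le (P := P) (G := G)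
      (H := H) (M := 4 * N) (k := repetitions c N) (K := δ * ε / 16 * n)
      (η := ((n : ℝ) ^ (c + 4))⁻¹) hn0 root hNn ?_ ?_ ?_ ?_).trans
      (error_sum_le hn hp1)))
    · intro seed hs
      by_contra hnone
      refine hs ⟨root, ?_⟩
      obtain ⟨F, hF, hv⟩ := hroot seed
      rw [hv root, if_pos rfl]
      congr 1
      change fingerprintVerdict (4 * N) (n ^ (c + 4)) (repetitions c N) H _ F = _
      rw [fingerprintVerdict, if_neg]
      rintro ⟨q, hq⟩
      exact hnone ⟨q, fun j hj => (hF j hj).symm.trans (hq j hj)⟩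
    · change (c + 5) * (4 * N) + c + 1 ≤ (c + 5) * (4 * n) + c + 1
      gcongr
    · exact (Nat.pow_lt_pow_right hn (by omega)).trans hp1
    · refine miss_probability_le hn0 hNn (by positivity) (hNlarge.imp_right fun h => ?_)
      push_cast
      have h1 : 0 ≤ ((c : ℝ) + 4) * Real.log n * (δ * ε / 16) := by positivity
      calc ((c : ℝ) + 4) * Real.log n
          ≤ ((c : ℝ) + 4) * Real.log n * (δ * ε / 16) + ((c : ℝ) + 4) * Real.log n := by linarith
        _ = ((c : ℝ) + 4) * Real.log n * (1 + 16 / (δ * ε)) * (δ * ε / 16) := by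
            field_simp
        _ ≤ N * (δ * ε / 16) := by gcongr
    · intro G' hG'
      have h1 := hfar G' hG'
      have h2 : ε * (δ * (n : ℝ) ^ 2) ≤ ε * (G.edgeSet.ncard : ℝ) := by gcongr
      have h3 : 0 < ε * (δ * (n : ℝ) ^ 2) := by positivity
      have h4 : 8 * (δ * ε / 16 * n * n) = ε * (δ * (n : ℝ) ^ 2) / 2 := by ring
      linarith
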